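/- Let $x_1,x_2,x_3,y_1,y_2,y_3$ be complex numbers, none of the $x_j$ an integer, such that the Saalschütz condition and the periodicity condition $$x_1+x_2+x_3+2=y_1+y_2+y_3,\qquad \sin\pi x_1\,\sin\pi x_2\,\sin\pi x_3=\sin\pi y_1\,\sin\pi y_2\,\sin\pi y_3$$ both hold (call such $(x,y)\in\mathbb C^3\times\mathbb C^3$ admissible). Then the bilateral series $$\sum_{n=-\infty}^{\infty}\ \prod_{i=1}^{3}\frac{\Gamma(x_i+n)}{\Gamma(y_i+n)}$$ converges absolutely and $$\sum_{n=-\infty}^{\infty}\ \prod_{i=1}^{3}\frac{\Gamma(x_i+n)}{\Gamma(y_i+n)}=\frac{G(x_1,x_2,x_3|y_1,y_2,y_3)}{\prod_{i=1}^{3}\prod_{j=1}^{3}\Gamma(y_i-x_j)},$$ where $$G(x_1,x_2,x_3|y_1,y_2,y_3)=\frac{\pi^5}{\sin\pi x_2\,\sin\pi x_3\,\prod_{i=1}^{3}\sin\pi(y_i-x_1)}=\prod_{j=2}^{3}\Gamma(x_j)\Gamma(1-x_j)\prod_{i=1}^{3}\Gamma(y_i-x_1)\Gamma(1-y_i+x_1).$$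 If some $y_i-x_1$ is an integer, so that $G$ is not defined at $(x,y)$, the right-hand side is understood as its limit along the admissible points $(x',y')$ with no $y'_i-x'_1$ an integer. More precisely, every admissible point $(x,y)$ lies in the closure of the set of admissible points $(x',y')$ with no $y'_i-x'_1$ an integer, and as $(x',y')\to(x,y)$ within that set, the right-hand side at $(x',y')$ tends to the sum of the series at $(x,y)$. -/

import Mathlib

open Filter Topology

noncomputable section

/-- The two conditions on the parameters (the Saalschütz condition and the periodicity
condition), together with the requirement that no `x j` is an integer. Indices `0, 1, 2` of
`Fin 3` stand for `1, 2, 3`. -/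
def Admissible (x y : Fin 3 → ℂ) : Prop :=
  x 0 + x 1 + x 2 + 2 = y 0 + y 1 + y 2 ∧
  Complex.sin (Real.pi * x 0) * Complex.sin (Real.pi * x 1) * Complex.sin (Real.pi * x 2) =
    Complex.sin (Real.pi * y 0) * Complex.sin (Real.pi * y 1) * Complex.sin (Real.pi * y 2) ∧
  ∀ (j : Fin 3) (k : ℤ), x j ≠ (k : ℂ)

/-- No difference `y i - x 0` is an integer: the remaining sines in the denominator of
`trigG` do not vanish. -/
def NonResonant (x y : Fin 3 → ℂ) : Prop :=
  ∀ (i : Fin 3) (k : ℤ), y i - x 0 ≠ (k : ℂ)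

/-- The `n`-th term of the bilateral series. If some `y i + n` is a nonpositive integer, Mathlib's
`Complex.Gamma (y i + n) = 0` and `a / 0 = 0` give the correct value `0` of the term. -/
def bilateralTerm (x y : Fin 3 → ℂ) (n : ℤ) : ℂ :=
  ∏ i : Fin 3, Complex.Gamma (x i + n) / Complex.Gamma (y i + n)

/-- The factor `G(x|y)` in trigonometric form. -/
def trigG (x y : Fin 3 → ℂ) : ℂ :=
  (Real.pi : ℂ) ^ 5 /
    (Complex.sin (Real.pi * x 1) * Complex.sin (Real.pi * x 2) *
      ∏ i : Fin 3, Complex.sin (Real.pi * (y i - x 0)))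

/-- The factor `G(x|y)` as a product of ten Gamma functions. -/
def gammaG (x y : Fin 3 → ℂ) : ℂ :=
  (Complex.Gamma (x 1) * Complex.Gamma (1 - x 1)) *
    (Complex.Gamma (x 2) * Complex.Gamma (1 - x 2)) *
    ∏ i : Fin 3, (Complex.Gamma (y i - x 0) * Complex.Gamma (1 - y i + x 0))

/-- The right-hand side `G(x|y) / ∏ i, ∏ j, Γ(y i - x j)`. -/
def closedForm (x y : Fin 3 → ℂ) : ℂ :=
  trigG x y / ∏ i : Fin 3, ∏ j : Fin 3, Complex.Gamma (y i - x j)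

/-- The admissible parameters `(x, y)` at which `G(x|y)` is finite. -/
def regularParams : Set ((Fin 3 → ℂ) × (Fin 3 → ℂ)) :=
  {p | Admissible p.1 p.2 ∧ NonResonant p.1 p.2}

end

open scoped Nat

namespace Bilateral

/-! The formula reduces to Dougall's bilateral sum for two Gamma ratios by contiguous relations and
a limit.

Cauchy's beta integral of `cos θ ^ p * exp (i u θ)` is a quotient of Gamma values
(`cosIntegral_eq`). Its values at `u - 2n` are, up to the factor `1/π`, Fourier coefficients of a
`π`-periodic function, so integrating one Fourier series against a second such function gives
Dougall's sum (`hasSum_gammaRatio_mul_gammaRatio`).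

For three ratios, Saalschütz's condition makes the term asymptotic to `n⁻²` at `+∞`. The periodicity
condition makes the reflection `n ↦ -n` an exact symmetry, so the same holds at `-∞`. Hence a
telescoping series whose certificate is quadratic in `n` times the term sums to zero: the boundary
limits are nonzero but equal. This yields two first-order recurrences, `tsum_shift_pair` and
`tsum_shift_lower`. Shifting `x₁` and `y₁` together to infinity turns the sum, after normalization,
into Dougall's; the expected value obeys the same recurrence with the same nonzero limit, so the two
agree when `y₂ - x₂` and `y₃ - x₃` have real part above `1`. Shifting lower parameters removes that
restriction.

These steps need every `y i - x j` to be non-integral. The cubics with roots `exp (2πi y)` and `exp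
(2πi x)` differ by `a z (z - 1)`, so a common root forces `a = 0` and equal root sets;
non-integrality of the `y i - x 0` alone therefore suffices.

At resonant points the limit statement has two ingredients: density of regular parameters, from the
open mapping theorem, and continuity of the sum on the admissible set, from a locally uniform Raabe
estimate. -/

/-! ### Asymptotics and reflection of Gamma ratios -/

theorem tendsto_natCast_div_add_natCast (s : ℂ) :
    Tendsto (fun n : ℕ => (n : ℂ) / (s + n)) atTop (𝓝 1) := by
  have := tendsto_natCast_div_add_atTop (𝕜 := ℂ) s
  simpa [add_comm] using this

theorem Gamma_add_natCast_eq {s : ℂ} (hs : ∀ k : ℕ, s ≠ -k) (n : ℕ) :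
    Complex.Gamma (s + n) = Complex.Gamma s * ∏ i ∈ Finset.range n, (s + i) := by
  induction n with
  | zero => simp
  | succ n ih =>
    have h : s + n ≠ 0 := fun h => hs n (by linear_combination h)
    rw [Finset.prod_range_succ, ← mul_assoc, ← ih, Nat.cast_succ, ← add_assoc,
      Complex.Gamma_add_one _ h, mul_comm]

theorem natCast_cpow_ne_zero {n : ℕ} (hn : (n : ℂ) ≠ 0) (s : ℂ) : (n : ℂ) ^ s ≠ 0 :=
  fun h => hn ((Complex.cpow_eq_zero_iff _ _).1 h).1

/-- This is Euler's limit for `Γ(s)`, rewritten with the product `s (s + 1) ⋯ (s + n - 1) = Γ(s + n)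
/ Γ(s)`. -/
theorem tendsto_Gamma_add_natCast_of_re_pos {s : ℂ} (hs : 0 < s.re) :
    Tendsto (fun n : ℕ => Complex.Gamma (s + n) / ((n : ℂ) ^ s * Complex.Gamma n)) atTop
      (𝓝 1) := by
  have hG : Complex.Gamma s ≠ 0 := Complex.Gamma_ne_zero_of_re_pos hs
  have hpole : ∀ k : ℕ, s ≠ -k := by
    rintro k rfl
    simp at hs
    have : (0 : ℝ) ≤ k := k.cast_nonneg
    linarith
  have h1 : Tendsto (fun n : ℕ => Complex.Gamma s / Complex.GammaSeq s n * ((n : ℂ) / (s + n)))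
      atTop (𝓝 1) := by
    have := ((tendsto_const_nhds (x := Complex.Gamma s)).div
      (Complex.GammaSeq_tendsto_Gamma s) hG).mul (tendsto_natCast_div_add_natCast s)
    simpa [div_self hG] using this
  refine h1.congr' ?_
  filter_upwards [eventually_gt_atTop 0] with n hn
  have hn0 : (n : ℂ) ≠ 0 := by exact_mod_cast hn.ne'
  have hsn : s + n ≠ 0 := fun h => hpole n (by linear_combination h)
  have h3 : Complex.Gamma (s + n) = Complex.Gamma s * ∏ i ∈ Finset.range n, (s + i) :=
    Gamma_add_natCast_eq hpole n
  have hprod : ∏ i ∈ Finset.range n, (s + i) ≠ 0 := by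
    rw [Finset.prod_ne_zero_iff]
    intro i _ h
    exact hpole i (by linear_combination h)
  obtain ⟨m, rfl⟩ : ∃ m, n = m + 1 := ⟨n - 1, by omega⟩
  have h4 : Complex.Gamma ((m + 1 : ℕ) : ℂ) = m ! := by
    push_cast; exact Complex.Gamma_nat_eq_factorial m
  have hfac : ((m ! : ℕ) : ℂ) ≠ 0 := by exact_mod_cast (Nat.factorial_pos m).ne'
  have hpow : ((m + 1 : ℕ) : ℂ) ^ s ≠ 0 := natCast_cpow_ne_zero hn0 _
  rw [h3, h4, Complex.GammaSeq, Finset.prod_range_succ _ (m + 1), Nat.factorial_succ]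
  generalize ∏ i ∈ Finset.range (m + 1), (s + i) = Q at *
  generalize ((m + 1 : ℕ) : ℂ) ^ s = R at *
  push_cast at *
  field_simp

/-- Descent from `s + 1` to `s` by the functional equation also reaches the poles of `Γ`, where
Euler's limit cannot be divided by `Γ(s)`. -/
theorem tendsto_Gamma_add_natCast (s : ℂ) :
    Tendsto (fun n : ℕ => Complex.Gamma (s + n) / ((n : ℂ) ^ s * Complex.Gamma n)) atTop
      (𝓝 1) := by
  obtain ⟨k, hk⟩ := exists_nat_gt (-s.re)
  induction k generalizing s with
  | zero => exact tendsto_Gamma_add_natCast_of_re_pos (by simpa using hk)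
  | succ k ih =>
    have h := (ih (s + 1) (by push_cast at hk; simp; linarith)).mul
      (tendsto_natCast_div_add_natCast s)
    rw [one_mul] at h
    refine h.congr' ?_
    obtain ⟨m, hm⟩ := exists_nat_gt (-s.re)
    filter_upwards [eventually_gt_atTop 0, eventually_ge_atTop m] with n hn hmn
    have hn0 : (n : ℂ) ≠ 0 := by exact_mod_cast hn.ne'
    have hsn : s + n ≠ 0 := by
      intro h
      have := congrArg Complex.re h
      simp at this
      have : (m : ℝ) ≤ n := by exact_mod_cast hmn
      linarith
    have e : s + 1 + n = (s + n) + 1 := by ring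
    have hpow : (n : ℂ) ^ s ≠ 0 := natCast_cpow_ne_zero hn0 _
    rw [e, Complex.Gamma_add_one _ hsn, Complex.cpow_add _ _ hn0, Complex.cpow_one]
    field_simp

/-- The ratio `Γ(a + n) / Γ(b + n)`. -/
noncomputable def gammaRatio (a b : ℂ) (n : ℤ) : ℂ := Complex.Gamma (a + n) / Complex.Gamma (b + n)

theorem tendsto_gammaRatio_mul_cpow (a b : ℂ) :
    Tendsto (fun n : ℕ => gammaRatio a b n * (n : ℂ) ^ (b - a)) atTop (𝓝 1) := by
  have h := (tendsto_Gamma_add_natCast a).div (tendsto_Gamma_add_natCast b) one_ne_zero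
  rw [div_one] at h
  refine h.congr' ?_
  filter_upwards [eventually_gt_atTop 0] with n hn
  have hn0 : (n : ℂ) ≠ 0 := by exact_mod_cast hn.ne'
  have hG : Complex.Gamma n ≠ 0 := Complex.Gamma_ne_zero_of_re_pos (by simpa using hn)
  have ha : (n : ℂ) ^ a ≠ 0 := natCast_cpow_ne_zero hn0 _
  have hb : (n : ℂ) ^ b ≠ 0 := natCast_cpow_ne_zero hn0 _
  simp only [gammaRatio, Int.cast_natCast, Pi.div_apply]
  rw [Complex.cpow_sub _ _ hn0]
  by_cases hz : Complex.Gamma (b + n) = 0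
  · simp [hz]
  · field_simp

theorem sin_pi_mul_ne_zero {a : ℂ} (ha : ∀ k : ℤ, a ≠ k) : Complex.sin (Real.pi * a) ≠ 0 := by
  rw [Complex.sin_ne_zero_iff]
  intro k hk
  have hpi : (Real.pi : ℂ) ≠ 0 := by exact_mod_cast Real.pi_ne_zero
  exact ha k (mul_left_cancel₀ hpi (by rw [hk]; ring))

theorem sin_pi_mul_intCast (k : ℤ) : Complex.sin (Real.pi * (k : ℂ)) = 0 := by
  rw [mul_comm]; exact Complex.sin_int_mul_pi k

theorem Gamma_ne_zero_of_ne_int {a : ℂ} (ha : ∀ k : ℤ, a ≠ k) : Complex.Gamma a ≠ 0 :=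
  Complex.Gamma_ne_zero fun m h => ha (-m) (by simpa using h)

theorem add_intCast_ne_int {a : ℂ} (ha : ∀ k : ℤ, a ≠ k) (n : ℤ) : ∀ k : ℤ, a + n ≠ k :=
  fun k h => ha (k - n) (by push_cast; linear_combination h)

theorem one_sub_ne_int {a : ℂ} (ha : ∀ k : ℤ, a ≠ k) : ∀ k : ℤ, 1 - a ≠ k :=
  fun k h => ha (1 - k) (by push_cast; linear_combination -h)

theorem add_intCast_ne_zero {a : ℂ} (ha : ∀ k : ℤ, a ≠ k) (n : ℤ) : a + n ≠ 0 := by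
  simpa using add_intCast_ne_int ha n 0

theorem gammaRatio_add_one {a b : ℂ} (ha : ∀ k : ℤ, a ≠ k) (hb : ∀ k : ℤ, b ≠ k) (n : ℤ) :
    gammaRatio a b (n + 1) = gammaRatio a b n * ((a + n) / (b + n)) := by
  have h1 : a + ((n + 1 : ℤ) : ℂ) = a + n + 1 := by push_cast; ring
  have h2 : b + ((n + 1 : ℤ) : ℂ) = b + n + 1 := by push_cast; ring
  rw [gammaRatio, gammaRatio, h1, h2, Complex.Gamma_add_one _ (add_intCast_ne_zero ha n),
    Complex.Gamma_add_one _ (add_intCast_ne_zero hb n), mul_comm, mul_comm (b + n), mul_div_mul_comm]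

theorem sin_pi_mul_sub_int (a : ℂ) (n : ℤ) :
    Complex.sin (Real.pi * (a - n)) = (-1) ^ n * Complex.sin (Real.pi * a) := by
  rw [mul_sub, mul_comm _ (n : ℂ), Complex.sin_sub, Complex.sin_int_mul_pi]
  have h : Complex.cos (n * Real.pi) = (-1) ^ n := by
    simpa using congrArg ((↑) : ℝ → ℂ) (Real.cos_int_mul_pi n)
  rw [h]
  ring

theorem Gamma_sub_int {a : ℂ} (ha : ∀ k : ℤ, a ≠ k) (n : ℤ) :
    Complex.Gamma (a - n) = Real.pi * (-1) ^ n /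
      (Complex.sin (Real.pi * a) * Complex.Gamma (1 - a + n)) := by
  have h := Complex.Gamma_mul_Gamma_one_sub (a - n)
  have e : 1 - (a - n) = 1 - a + n := by ring
  have hG : Complex.Gamma (1 - a + n) ≠ 0 :=
    Gamma_ne_zero_of_ne_int (add_intCast_ne_int (one_sub_ne_int ha) n)
  have hs := sin_pi_mul_ne_zero ha
  rw [e, sin_pi_mul_sub_int] at h
  have h1 : ((-1 : ℂ) ^ n) * (-1) ^ n = 1 := by
    rw [← mul_zpow]; simp
  have h2 : ((-1 : ℂ) ^ n) ≠ 0 := zpow_ne_zero _ (by norm_num)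
  have hn : (-1 : ℂ) ^ n * Complex.sin (Real.pi * a) ≠ 0 := mul_ne_zero h2 hs
  rw [eq_div_iff hn] at h
  rw [eq_div_iff (mul_ne_zero hs hG)]
  linear_combination (-1) ^ n * h - Complex.Gamma (a - n) * Complex.sin (Real.pi * a) *
    Complex.Gamma (1 - a + n) * h1

/-- The reflection formula is applied to both Gamma values and the signs `(-1)^n` cancel. Behaviour
at `-∞` thereby reduces to behaviour at `+∞`. -/
theorem gammaRatio_neg {a b : ℂ} (ha : ∀ k : ℤ, a ≠ k) (hb : ∀ k : ℤ, b ≠ k) (n : ℤ) :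
    gammaRatio a b (-n) = Complex.sin (Real.pi * b) / Complex.sin (Real.pi * a) *
      gammaRatio (1 - b) (1 - a) n := by
  have hG : Complex.Gamma (1 - a + n) ≠ 0 :=
    Gamma_ne_zero_of_ne_int (add_intCast_ne_int (one_sub_ne_int ha) n)
  have hG' : Complex.Gamma (1 - b + n) ≠ 0 :=
    Gamma_ne_zero_of_ne_int (add_intCast_ne_int (one_sub_ne_int hb) n)
  have hs := sin_pi_mul_ne_zero ha
  have hs' := sin_pi_mul_ne_zero hb
  have h2 : ((-1 : ℂ) ^ n) ≠ 0 := zpow_ne_zero _ (by norm_num)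
  have hpi : (Real.pi : ℂ) ≠ 0 := by exact_mod_cast Real.pi_ne_zero
  simp only [gammaRatio, Int.cast_neg, ← sub_eq_add_neg]
  rw [Gamma_sub_int ha, Gamma_sub_int hb]
  field_simp

theorem exists_norm_gammaRatio_natCast_le (a b : ℂ) :
    ∃ C : ℝ, 0 ≤ C ∧ ∀ n : ℕ, ‖gammaRatio a b n‖ ≤ C * (1 + (n : ℝ)) ^ (a.re - b.re) := by
  have h1 : Tendsto (fun n : ℕ => ((n : ℝ) / (1 + n)) ^ (a.re - b.re)) atTop (𝓝 1) := by
    have h0 : Tendsto (fun n : ℕ => (n : ℝ) / (1 + n)) atTop (𝓝 1) := by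
      have := tendsto_natCast_div_add_atTop (𝕜 := ℝ) 1
      simpa [add_comm] using this
    have := h0.rpow_const (p := a.re - b.re) (Or.inl one_ne_zero)
    simpa using this
  have h := ((tendsto_gammaRatio_mul_cpow a b).norm).mul h1
  obtain ⟨C, hC⟩ := h.bddAbove_range
  refine ⟨max C ‖gammaRatio a b 0‖, le_max_of_le_right (norm_nonneg _), fun n => ?_⟩
  rcases Nat.eq_zero_or_pos n with rfl | hn
  · simp
  have hn' : (0 : ℝ) < n := by exact_mod_cast hn
  have hCn := hC ⟨n, rfl⟩
  simp only at hCn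
  rw [norm_mul, Complex.norm_natCast_cpow_of_pos hn, Real.div_rpow hn'.le (by positivity)] at hCn
  have e : (n : ℝ) ^ (b - a).re * (n : ℝ) ^ (a.re - b.re) = 1 := by
    rw [← Real.rpow_add hn']; simp
  have hpos : 0 < (1 + (n : ℝ)) ^ (a.re - b.re) := by positivity
  rw [mul_assoc, mul_div_assoc', e, mul_one_div, div_le_iff₀ hpos] at hCn
  exact hCn.trans (mul_le_mul_of_nonneg_right (le_max_left _ _) hpos.le)

theorem exists_norm_gammaRatio_le {a b : ℂ} (ha : ∀ k : ℤ, a ≠ k) (hb : ∀ k : ℤ, b ≠ k) :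
    ∃ C : ℝ, 0 ≤ C ∧ ∀ n : ℤ, ‖gammaRatio a b n‖ ≤ C * (1 + |(n : ℝ)|) ^ (a.re - b.re) := by
  obtain ⟨C₁, h₁, hC₁⟩ := exists_norm_gammaRatio_natCast_le a b
  obtain ⟨C₂, h₂, hC₂⟩ := exists_norm_gammaRatio_natCast_le (1 - b) (1 - a)
  set K := ‖Complex.sin (Real.pi * b) / Complex.sin (Real.pi * a)‖ with hK
  refine ⟨max C₁ (K * C₂), le_max_of_le_left h₁, fun n => ?_⟩
  have hpos : 0 ≤ (1 + |(n : ℝ)|) ^ (a.re - b.re) := by positivity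
  obtain ⟨m, rfl | rfl⟩ := n.eq_nat_or_neg
  · refine le_trans ?_ (mul_le_mul_of_nonneg_right (le_max_left _ _) hpos)
    simpa using hC₁ m
  · refine le_trans ?_ (mul_le_mul_of_nonneg_right (le_max_right _ _) hpos)
    rw [gammaRatio_neg ha hb, norm_mul, ← hK, mul_assoc]
    refine mul_le_mul_of_nonneg_left ?_ (norm_nonneg _)
    have := hC₂ m
    simp only [Complex.sub_re, Complex.one_re, sub_sub_sub_cancel_left] at this
    simpa using this

/-! ### Evaluation of Cauchy's beta integral -/

theorem norm_exp_sub_one_le_of_re_nonpos {w : ℂ} (hw : w.re ≤ 0) :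
    ‖Complex.exp w - 1‖ ≤ ‖w‖ := by
  have h := (convex_halfSpace_re_le 0).norm_image_sub_le_of_norm_deriv_le (f := Complex.exp)
    (C := 1) (fun x _ => Complex.differentiableAt_exp) (fun x hx => by
      rw [Complex.deriv_exp, Complex.norm_exp]
      exact Real.exp_le_one_iff.2 hx) (x := 0) (y := w) (by simp) hw
  simpa using h

theorem norm_exp_sub_one_le_mul_exp (w : ℂ) : ‖Complex.exp w - 1‖ ≤ ‖w‖ * Real.exp ‖w‖ := by
  simpa using Complex.norm_exp_sub_sum_le_norm_mul_exp w 1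

/-- Cauchy's beta integral `∫ (cos θ)^p e^{iuθ} dθ` over `[-π/2, π/2]`. -/
noncomputable def cosIntegral (p u : ℂ) : ℂ :=
  ∫ θ in -(Real.pi / 2)..Real.pi / 2,
    (Real.cos θ : ℂ) ^ p * Complex.exp (Complex.I * u * θ)

theorem continuous_cos_cpow {p : ℂ} (hp : 0 < p.re) :
    Continuous fun θ : ℝ => (Real.cos θ : ℂ) ^ p :=
  (Complex.continuous_ofReal_cpow_const hp).comp Real.continuous_cos

theorem continuous_cos_cpow' {p : ℂ} (hp : 0 < p.re ∨ p = 0) :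
    Continuous fun θ : ℝ => (Real.cos θ : ℂ) ^ p := by
  rcases hp with hp | rfl
  · exact continuous_cos_cpow hp
  · simpa using continuous_const

theorem cosIntegral_add_two {p : ℂ} (hp : 0 < p.re ∨ p = 0) (u : ℂ) :
    (p + 1) * (p + 2) * cosIntegral p u = ((p + 2) ^ 2 - u ^ 2) * cosIntegral (p + 2) u := by
  have hre : 0 ≤ p.re := hp.elim le_of_lt fun h => by simp [h]
  have hc0 := continuous_cos_cpow' hp
  have hc1 : Continuous fun θ : ℝ => (Real.cos θ : ℂ) ^ (p + 1) :=
    continuous_cos_cpow (by simp; linarith)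
  have hc2 : Continuous fun θ : ℝ => (Real.cos θ : ℂ) ^ (p + 2) :=
    continuous_cos_cpow (by simp; linarith)
  have hE : Continuous fun θ : ℝ => Complex.exp (Complex.I * u * θ) := by fun_prop
  have hS : Continuous fun θ : ℝ => (Real.sin θ : ℂ) := by fun_prop
  have hlt : -(Real.pi / 2) ≤ Real.pi / 2 := by linarith [Real.pi_pos]
  -- Two integrations by parts at once: this primitive vanishes at both ends, and its derivative is
  -- the difference of the two integrands.
  have key := intervalIntegral.integral_eq_sub_of_hasDerivAt_of_le
    (f := fun θ : ℝ => ((p + 2) * ((Real.cos θ : ℂ) ^ (p + 1) * Real.sin θ)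
      + Complex.I * u * (Real.cos θ : ℂ) ^ (p + 2)) * Complex.exp (Complex.I * u * θ))
    (f' := fun θ : ℝ => ((p + 2) ^ 2 - u ^ 2) *
        ((Real.cos θ : ℂ) ^ (p + 2) * Complex.exp (Complex.I * u * θ))
      - (p + 1) * (p + 2) * ((Real.cos θ : ℂ) ^ p * Complex.exp (Complex.I * u * θ)))
    hlt (by fun_prop) (fun θ hθ => ?_) (Continuous.intervalIntegrable (by fun_prop) _ _)
  · rw [intervalIntegral.integral_sub (Continuous.intervalIntegrable (by fun_prop) _ _)
      (Continuous.intervalIntegrable (by fun_prop) _ _), intervalIntegral.integral_const_mul,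
      intervalIntegral.integral_const_mul] at key
    have z1 : p + 1 ≠ 0 := fun h => by
      have := congrArg Complex.re h; simp at this; linarith
    have z2 : p + 2 ≠ 0 := fun h => by
      have := congrArg Complex.re h; simp at this; linarith
    simp only [Real.cos_neg, Real.cos_pi_div_two, Complex.ofReal_zero, Complex.zero_cpow z1,
      Complex.zero_cpow z2] at key
    simp only [cosIntegral]
    linear_combination -key
  · have hcos : 0 < Real.cos θ := Real.cos_pos_of_mem_Ioo hθ
    have hcC : (Real.cos θ : ℂ) ≠ 0 := by exact_mod_cast hcos.ne'
    have hslit : (Real.cos θ : ℂ) ∈ Complex.slitPlane := Complex.ofReal_mem_slitPlane.2 hcos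
    have dcos : HasDerivAt (fun t : ℝ => (Real.cos t : ℂ)) (-(Real.sin θ : ℂ)) θ := by
      simpa using (Real.hasDerivAt_cos θ).ofReal_comp
    have dsin : HasDerivAt (fun t : ℝ => (Real.sin t : ℂ)) (Real.cos θ : ℂ) θ := by
      simpa using (Real.hasDerivAt_sin θ).ofReal_comp
    have dexp : HasDerivAt (fun t : ℝ => Complex.exp (Complex.I * u * t))
        (Complex.exp (Complex.I * u * θ) * (Complex.I * u * 1)) θ :=
      ((Complex.ofRealCLM.hasDerivAt (x := θ)).const_mul (Complex.I * u)).cexp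
    have dpow (q : ℂ) : HasDerivAt (fun t : ℝ => (Real.cos t : ℂ) ^ q)
        (q * (Real.cos θ : ℂ) ^ (q - 1) * (-(Real.sin θ : ℂ))) θ := by
      have h1 : HasDerivAt (fun z : ℂ => z ^ q) (q * (Real.cos θ : ℂ) ^ (q - 1)) (Real.cos θ : ℂ) := by
        simpa using (hasDerivAt_id (Real.cos θ : ℂ)).cpow_const (c := q) hslit
      exact h1.comp θ dcos
    have h := ((((dpow (p + 1)).mul dsin).const_mul (p + 2)).add
      ((dpow (p + 2)).const_mul (Complex.I * u))).mul dexp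
    refine h.congr_deriv ?_
    have e1 : p + 1 - 1 = p := by ring
    have e2 : p + 2 - 1 = p + 1 := by ring
    have hs2 : (Real.sin θ : ℂ) ^ 2 = 1 - (Real.cos θ : ℂ) ^ 2 := by
      have := Real.sin_sq θ
      exact_mod_cast this
    have q1 : (Real.cos θ : ℂ) ^ (p + 1) = (Real.cos θ : ℂ) ^ p * Real.cos θ := by
      rw [Complex.cpow_add _ _ hcC, Complex.cpow_one]
    have q2 : (Real.cos θ : ℂ) ^ (p + 2) = (Real.cos θ : ℂ) ^ p * (Real.cos θ : ℂ) ^ 2 := by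
      rw [Complex.cpow_add _ _ hcC]; norm_num
    simp only [Pi.mul_apply, Pi.add_apply]
    rw [e1, e2, q1, q2]
    linear_combination (-(p + 1) * (p + 2) * (Real.cos θ : ℂ) ^ p *
      Complex.exp (Complex.I * u * θ)) * hs2 + (u ^ 2 * (Real.cos θ : ℂ) ^ p *
      (Real.cos θ : ℂ) ^ 2 * Complex.exp (Complex.I * u * θ)) * Complex.I_sq

/-- The accumulated factor in `N` steps `p ↦ p + 2` of Cauchy's beta integral. -/
noncomputable def cosFactor (p u : ℂ) (N : ℕ) : ℂ :=
  (∏ k ∈ Finset.range N, ((1 + (p + u) / 2) + k)) * (∏ k ∈ Finset.range N, ((1 + (p - u) / 2) + k)) /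
    ((∏ k ∈ Finset.range N, ((p + 1) / 2 + k)) * (∏ k ∈ Finset.range N, ((p + 2) / 2 + k)))

theorem add_natCast_ne_zero_of_re_pos {a : ℂ} (ha : 0 < a.re) (k : ℕ) : a + k ≠ 0 := fun h => by
  have h1 := congrArg Complex.re h
  simp at h1
  have : (0 : ℝ) ≤ k := k.cast_nonneg
  linarith

theorem cosIntegral_eq_cosFactor_mul {p : ℂ} (hp : 0 < p.re ∨ p = 0) (u : ℂ) (N : ℕ) :
    cosIntegral p u = cosFactor p u N * cosIntegral (p + 2 * N) u := by
  have hre : 0 ≤ p.re := hp.elim le_of_lt fun h => by simp [h]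
  have b1 : 0 < ((p + 1) / 2).re := by simp; linarith
  have b2 : 0 < ((p + 2) / 2).re := by simp; linarith
  induction N with
  | zero => simp [cosFactor]
  | succ N ih =>
    have n1 := add_natCast_ne_zero_of_re_pos b1 N
    have n2 := add_natCast_ne_zero_of_re_pos b2 N
    have h := cosIntegral_add_two (p := p + 2 * N) (by
      rcases Nat.eq_zero_or_pos N with rfl | hN
      · simpa using hp
      · left
        have : (0 : ℝ) < N := by exact_mod_cast hN
        simp; linarith) u
    have e : p + 2 * ((N + 1 : ℕ) : ℂ) = p + 2 * N + 2 := by push_cast; ring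
    rw [ih, e, cosFactor, cosFactor]
    simp only [Finset.prod_range_succ]
    have h' : cosIntegral (p + 2 * N) u = (1 + (p + u) / 2 + N) * (1 + (p - u) / 2 + N) /
        (((p + 1) / 2 + N) * ((p + 2) / 2 + N)) * cosIntegral (p + 2 * N + 2) u := by
      rw [div_mul_eq_mul_div, eq_div_iff (mul_ne_zero n1 n2)]
      linear_combination h / 4
    rw [h']
    simp only [div_eq_mul_inv, mul_inv]
    ring

/-- At `a = -m` the products vanish eventually, in agreement with the convention `Γ(-m) = 0` and
`0⁻¹ = 0`. -/
theorem tendsto_prod_range_add_div (a : ℂ) :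
    Tendsto (fun N : ℕ => (∏ k ∈ Finset.range N, (a + k)) / ((N : ℂ) ^ a * Complex.Gamma N)) atTop
      (𝓝 (Complex.Gamma a)⁻¹) := by
  by_cases ha : ∀ k : ℕ, a ≠ -k
  · have h := (tendsto_Gamma_add_natCast a).const_mul (Complex.Gamma a)⁻¹
    rw [mul_one] at h
    refine h.congr fun N => ?_
    have := Complex.Gamma_ne_zero ha
    rw [Gamma_add_natCast_eq ha, ← mul_div_assoc, inv_mul_cancel_left₀ this]
  · push Not at ha
    obtain ⟨m, rfl⟩ := ha
    rw [Complex.Gamma_neg_nat_eq_zero, inv_zero]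
    refine tendsto_const_nhds.congr' ?_
    filter_upwards [eventually_gt_atTop m] with N hN
    rw [Finset.prod_eq_zero (Finset.mem_range.2 hN) (by simp), zero_div]

theorem tendsto_cosFactor_div {p : ℂ} (hp : 0 ≤ p.re) (u : ℂ) :
    Tendsto (fun N : ℕ => cosFactor p u N / (N : ℂ) ^ (1 / 2 : ℂ)) atTop
      (𝓝 (Complex.Gamma ((p + 1) / 2) * Complex.Gamma ((p + 2) / 2) /
        (Complex.Gamma (1 + (p + u) / 2) * Complex.Gamma (1 + (p - u) / 2)))) := by
  have b1 : 0 < ((p + 1) / 2).re := by simp; linarith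
  have b2 : 0 < ((p + 2) / 2).re := by simp; linarith
  have g1 := Complex.Gamma_ne_zero_of_re_pos b1
  have g2 := Complex.Gamma_ne_zero_of_re_pos b2
  have h := ((tendsto_prod_range_add_div (1 + (p + u) / 2)).mul
    (tendsto_prod_range_add_div (1 + (p - u) / 2))).div
    ((tendsto_prod_range_add_div ((p + 1) / 2)).mul (tendsto_prod_range_add_div ((p + 2) / 2)))
    (mul_ne_zero (inv_ne_zero g1) (inv_ne_zero g2))
  have e : (Complex.Gamma (1 + (p + u) / 2))⁻¹ * (Complex.Gamma (1 + (p - u) / 2))⁻¹ /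
      ((Complex.Gamma ((p + 1) / 2))⁻¹ * (Complex.Gamma ((p + 2) / 2))⁻¹) =
      Complex.Gamma ((p + 1) / 2) * Complex.Gamma ((p + 2) / 2) /
        (Complex.Gamma (1 + (p + u) / 2) * Complex.Gamma (1 + (p - u) / 2)) := by
    rw [← mul_inv, ← mul_inv, div_inv_eq_mul, mul_comm, ← div_eq_mul_inv]
  rw [e] at h
  refine h.congr' ?_
  filter_upwards [eventually_gt_atTop 0] with N hN
  have hN0 : (N : ℂ) ≠ 0 := by exact_mod_cast hN.ne'
  have hG : Complex.Gamma N ≠ 0 := Complex.Gamma_ne_zero_of_re_pos (by simpa using hN)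
  -- The numerator exponents add up to `p + 2` and the denominator ones to `p + 3/2`; the excess is
  -- the square root of `N`.
  have hpw : (N : ℂ) ^ (1 + (p + u) / 2) * (N : ℂ) ^ (1 + (p - u) / 2) =
      (N : ℂ) ^ ((p + 1) / 2) * (N : ℂ) ^ ((p + 2) / 2) * (N : ℂ) ^ (1 / 2 : ℂ) := by
    rw [← Complex.cpow_add _ _ hN0, ← Complex.cpow_add _ _ hN0, ← Complex.cpow_add _ _ hN0]
    congr 1; ring
  simp only [Pi.div_apply, cosFactor]
  have k1 := natCast_cpow_ne_zero hN0 (1 + (p + u) / 2)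
  have k2 := natCast_cpow_ne_zero hN0 (1 + (p - u) / 2)
  have k3 := natCast_cpow_ne_zero hN0 ((p + 1) / 2)
  have k4 := natCast_cpow_ne_zero hN0 ((p + 2) / 2)
  have k5 := natCast_cpow_ne_zero hN0 (1 / 2)
  have k6 : ∏ k ∈ Finset.range N, ((p + 1) / 2 + (k : ℂ)) ≠ 0 :=
    Finset.prod_ne_zero_iff.2 fun k _ => add_natCast_ne_zero_of_re_pos b1 k
  have k7 : ∏ k ∈ Finset.range N, ((p + 2) / 2 + (k : ℂ)) ≠ 0 :=
    Finset.prod_ne_zero_iff.2 fun k _ => add_natCast_ne_zero_of_re_pos b2 k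
  generalize ∏ k ∈ Finset.range N, ((p + 1) / 2 + (k : ℂ)) = A at *
  generalize ∏ k ∈ Finset.range N, ((p + 2) / 2 + (k : ℂ)) = B at *
  generalize ∏ k ∈ Finset.range N, (1 + (p + u) / 2 + (k : ℂ)) = C at *
  generalize ∏ k ∈ Finset.range N, (1 + (p - u) / 2 + (k : ℂ)) = D at *
  generalize (N : ℂ) ^ (1 + (p + u) / 2) = E1 at *
  generalize (N : ℂ) ^ (1 + (p - u) / 2) = E2 at *
  generalize (N : ℂ) ^ ((p + 1) / 2) = E3 at *
  generalize (N : ℂ) ^ ((p + 2) / 2) = E4 at *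
  generalize (N : ℂ) ^ (1 / 2 : ℂ) = E5 at *
  generalize Complex.Gamma N = G at *
  rw [div_mul_div_comm, div_mul_div_comm, div_div_div_eq, div_div,
    div_eq_div_iff (by positivity) (by positivity)]
  linear_combination (-(C * D * A * B * G ^ 2)) * hpw

theorem cosIntegral_two_mul_natCast (N : ℕ) : cosIntegral ((2 * N : ℕ) : ℂ) 0 =
    ((∫ θ in -(Real.pi / 2)..Real.pi / 2, Real.cos θ ^ (2 * N) : ℝ) : ℂ) := by
  rw [cosIntegral, ← intervalIntegral.integral_ofReal]
  refine intervalIntegral.integral_congr fun θ _ => ?_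
  simp only [Complex.cpow_natCast]
  simp

/-- Both `cos θ ^ p - 1` and `exp (i u θ) - 1` are `O(|sin θ| / cos θ)`; the division costs one
power of the cosine. -/
theorem norm_cos_cpow_mul_exp_sub_le {p : ℂ} (hp : 0 ≤ p.re) (u : ℂ) :
    ∃ M : ℝ, 0 ≤ M ∧ ∀ N : ℕ, 0 < N → ∀ θ ∈ Set.Icc (-(Real.pi / 2)) (Real.pi / 2),
      ‖(Real.cos θ : ℂ) ^ (p + (2 * N : ℕ)) * Complex.exp (Complex.I * u * θ) -
        (Real.cos θ : ℂ) ^ ((2 * N : ℕ) : ℂ)‖ ≤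
      M * (Real.cos θ ^ (2 * N - 1) * |Real.sin θ|) := by
  have hpi := Real.pi_pos
  refine ⟨‖u‖ * (Real.pi / 2) * Real.exp (‖u‖ * (Real.pi / 2)) + ‖p‖, by positivity,
    fun N hN θ hθ => ?_⟩
  have hc : 0 ≤ Real.cos θ := Real.cos_nonneg_of_mem_Icc hθ
  rcases hc.eq_or_lt with h0 | hc
  · rw [← h0, Complex.ofReal_zero, Complex.zero_cpow, Complex.zero_cpow]
    · rw [zero_pow (by omega)]; simp
    · exact_mod_cast (by omega : 2 * N ≠ 0)
    · intro h
      have h1 := congrArg Complex.re h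
      have : (0 : ℝ) < N := by exact_mod_cast hN
      simp at h1
      linarith
  have hcC : (Real.cos θ : ℂ) ≠ 0 := by exact_mod_cast hc.ne'
  set c := Real.cos θ with hcdef
  set s := |Real.sin θ| with hs
  have hs0 : 0 ≤ s := abs_nonneg _
  have hsc : s ^ 2 = 1 - c ^ 2 := by rw [hs, sq_abs, Real.sin_sq]
  have hc1 : c ≤ 1 := Real.cos_le_one θ
  have hs1 : s ≤ 1 := Real.abs_sin_le_one θ
  have hθs : |θ| ≤ Real.pi / 2 * s := by
    have := Real.mul_abs_le_abs_sin (abs_le.2 hθ)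
    rw [hs, ← div_le_iff₀' (by positivity)]
    calc |θ| / (Real.pi / 2) = 2 / Real.pi * |θ| := by field_simp
      _ ≤ _ := this
  have hlog : -Real.log c ≤ s / c := by
    have h1 := Real.log_le_sub_one_of_pos (inv_pos.2 hc)
    rw [Real.log_inv] at h1
    refine h1.trans ?_
    rw [← one_div, div_sub_one hc.ne']
    gcongr
    nlinarith
  have hlog0 : Real.log c ≤ 0 := Real.log_nonpos hc.le hc1
  have hpw : (c : ℂ) ^ p = Complex.exp (Real.log c * p) := by
    rw [Complex.cpow_def_of_ne_zero hcC, Complex.ofReal_log hc.le]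
  have hA : ‖(c : ℂ) ^ p - 1‖ ≤ ‖p‖ * (s / c) := by
    rw [hpw]
    refine (norm_exp_sub_one_le_of_re_nonpos ?_).trans ?_
    · simp only [Complex.re_ofReal_mul]
      exact mul_nonpos_of_nonpos_of_nonneg hlog0 hp
    · rw [norm_mul, Complex.norm_real, Real.norm_eq_abs, abs_of_nonpos hlog0, mul_comm]
      gcongr
  have hA' : ‖(c : ℂ) ^ p‖ ≤ 1 := by
    rw [Complex.norm_cpow_eq_rpow_re_of_pos hc]
    exact Real.rpow_le_one hc.le hc1 hp
  have hB : ‖Complex.exp (Complex.I * u * θ) - 1‖ ≤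
      ‖u‖ * (Real.pi / 2) * Real.exp (‖u‖ * (Real.pi / 2)) * (s / c) := by
    have e : ‖Complex.I * u * (θ : ℂ)‖ = ‖u‖ * |θ| := by simp
    refine (norm_exp_sub_one_le_mul_exp _).trans ?_
    rw [e]
    have hsle : s ≤ s / c := le_div_self hs0 hc hc1
    calc ‖u‖ * |θ| * Real.exp (‖u‖ * |θ|)
        ≤ ‖u‖ * (Real.pi / 2 * (s / c)) * Real.exp (‖u‖ * (Real.pi / 2)) := by
          gcongr
          · exact hθs.trans (by gcongr)
          · exact hθs.trans (mul_le_of_le_one_right (by positivity) hs1)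
      _ = _ := by ring
  have hfac : (c : ℂ) ^ (p + (2 * N : ℕ)) * Complex.exp (Complex.I * u * θ) -
      (c : ℂ) ^ ((2 * N : ℕ) : ℂ) = (c : ℂ) ^ (2 * N) *
      ((c : ℂ) ^ p * (Complex.exp (Complex.I * u * θ) - 1) + ((c : ℂ) ^ p - 1)) := by
    rw [Complex.cpow_add _ _ hcC, Complex.cpow_natCast]; ring
  rw [hfac, norm_mul, norm_pow, Complex.norm_real, Real.norm_eq_abs, abs_of_pos hc]
  have hsplit : c ^ (2 * N) = c ^ (2 * N - 1) * c := by
    rw [← pow_succ]; congr 1; omega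
  calc c ^ (2 * N) * ‖(c : ℂ) ^ p * (Complex.exp (Complex.I * u * θ) - 1) + ((c : ℂ) ^ p - 1)‖
      ≤ c ^ (2 * N) * (1 * (‖u‖ * (Real.pi / 2) * Real.exp (‖u‖ * (Real.pi / 2)) * (s / c)) +
          ‖p‖ * (s / c)) := by
        gcongr
        refine (norm_add_le _ _).trans ?_
        rw [norm_mul]
        gcongr
    _ = _ := by rw [hsplit]; field_simp

/-- Weighted AM-GM bounds `cos θ |sin θ|` by `cos² θ / (2r) + r sin² θ / 2`. With `r² = 2N - 1`,
Wallis's recurrence makes the two resulting integrals equal. -/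
theorem integral_cos_pow_mul_abs_sin_le (N : ℕ) (hN : 0 < N) :
    ∫ θ in -(Real.pi / 2)..Real.pi / 2, Real.cos θ ^ (2 * N - 1) * |Real.sin θ| ≤
      (∫ θ in -(Real.pi / 2)..Real.pi / 2, Real.cos θ ^ (2 * N)) / √(2 * N - 1) := by
  have hN' : (1 : ℝ) ≤ N := by exact_mod_cast hN
  have hpos : (0 : ℝ) < 2 * N - 1 := by linarith
  set r := √(2 * (N : ℝ) - 1) with hr
  have hr0 : 0 < r := Real.sqrt_pos.2 hpos
  have hr2 : r ^ 2 = 2 * N - 1 := Real.sq_sqrt hpos.le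
  obtain ⟨m, rfl⟩ : ∃ m, N = m + 1 := ⟨N - 1, by omega⟩
  have hrec : (2 * ((m + 1 : ℕ) : ℝ) - 1) * ∫ θ in -(Real.pi / 2)..Real.pi / 2, Real.cos θ ^ (2 * m) =
      2 * ((m + 1 : ℕ) : ℝ) * ∫ θ in -(Real.pi / 2)..Real.pi / 2, Real.cos θ ^ (2 * (m + 1)) := by
    have h := integral_cos_pow (a := -(Real.pi / 2)) (b := Real.pi / 2) (2 * m)
    rw [show 2 * (m + 1) = 2 * m + 2 by ring, h]
    simp only [Real.cos_pi_div_two, Real.cos_neg]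
    rw [zero_pow (by omega)]
    push_cast
    field_simp
    ring
  have hlt : -(Real.pi / 2) ≤ Real.pi / 2 := by linarith [Real.pi_pos]
  have hi (k : ℕ) : IntervalIntegrable (fun θ => Real.cos θ ^ k) MeasureTheory.volume
      (-(Real.pi / 2)) (Real.pi / 2) := Continuous.intervalIntegrable (by fun_prop) _ _
  have hle : ∫ θ in -(Real.pi / 2)..Real.pi / 2, Real.cos θ ^ (2 * (m + 1) - 1) * |Real.sin θ| ≤
      ∫ θ in -(Real.pi / 2)..Real.pi / 2,
        (1 / (2 * r) * Real.cos θ ^ (2 * (m + 1)) +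
          r / 2 * (Real.cos θ ^ (2 * m) - Real.cos θ ^ (2 * (m + 1)))) := by
    refine intervalIntegral.integral_mono_on hlt (Continuous.intervalIntegrable (by fun_prop) _ _)
      (Continuous.intervalIntegrable (by fun_prop) _ _) fun θ _ => ?_
    have h1 : Real.cos θ ^ (2 * (m + 1) - 1) = Real.cos θ ^ (2 * m) * Real.cos θ := by
      rw [← pow_succ]; congr 1
    have h2 : Real.cos θ ^ (2 * (m + 1)) = Real.cos θ ^ (2 * m) * Real.cos θ ^ 2 := by
      rw [← pow_add]; rfl
    have h3 : 0 ≤ Real.cos θ ^ (2 * m) := by rw [pow_mul]; positivity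
    have h4 : Real.cos θ * |Real.sin θ| ≤
        1 / (2 * r) * Real.cos θ ^ 2 + r / 2 * (1 - Real.cos θ ^ 2) := by
      have h5 : 1 - Real.cos θ ^ 2 = |Real.sin θ| ^ 2 := by rw [sq_abs, Real.sin_sq]
      rw [h5, ← sub_nonneg]
      have : 1 / (2 * r) * Real.cos θ ^ 2 + r / 2 * |Real.sin θ| ^ 2 - Real.cos θ * |Real.sin θ| =
        (Real.cos θ - r * |Real.sin θ|) ^ 2 / (2 * r) := by field_simp; ring
      rw [this]; positivity
    rw [h1, h2]
    nlinarith [mul_le_mul_of_nonneg_left h4 h3]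
  refine hle.trans_eq ?_
  rw [intervalIntegral.integral_add ((hi _).const_mul _) (((hi _).sub (hi _)).const_mul _),
    intervalIntegral.integral_const_mul, intervalIntegral.integral_const_mul,
    intervalIntegral.integral_sub (hi _) (hi _)]
  generalize (∫ θ in -(Real.pi / 2)..Real.pi / 2, Real.cos θ ^ (2 * m)) = A at *
  generalize (∫ θ in -(Real.pi / 2)..Real.pi / 2, Real.cos θ ^ (2 * (m + 1))) = B at *
  rw [← hr2] at hrec
  have h2N : 2 * ((m + 1 : ℕ) : ℝ) = r ^ 2 + 1 := by linarith
  rw [h2N] at hrec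
  field_simp
  linarith

/-- For large `N` the mass of `cos θ ^ (2N)` concentrates at `θ = 0`, where the extra factor `cos θ
^ p * exp (i u θ)` equals `1`. -/
theorem tendsto_cosIntegral_div {p : ℂ} (hp : 0 ≤ p.re) (u : ℂ) :
    Tendsto (fun N : ℕ => cosIntegral (p + 2 * N) u / cosIntegral ((2 * N : ℕ) : ℂ) 0) atTop
      (𝓝 1) := by
  obtain ⟨M, hM, hb⟩ := norm_cos_cpow_mul_exp_sub_le hp u
  have hlt : -(Real.pi / 2) ≤ Real.pi / 2 := by linarith [Real.pi_pos]
  have hlt' : -(Real.pi / 2) < Real.pi / 2 := by linarith [Real.pi_pos]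
  rw [tendsto_iff_norm_sub_tendsto_zero]
  have hlim : Tendsto (fun N : ℕ => M / √(2 * N - 1)) atTop (𝓝 0) := by
    refine tendsto_const_nhds.div_atTop (Real.tendsto_sqrt_atTop.comp ?_)
    exact tendsto_atTop_add_const_right _ _
      (tendsto_natCast_atTop_atTop.const_mul_atTop (by norm_num))
  refine squeeze_zero' (Eventually.of_forall fun _ => norm_nonneg _) ?_ hlim
  filter_upwards [eventually_gt_atTop 0] with N hN
  set A := ∫ θ in -(Real.pi / 2)..Real.pi / 2, Real.cos θ ^ (2 * N) with hAdef
  have hA : 0 < A := by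
    refine intervalIntegral.intervalIntegral_pos_of_pos_on
      (Continuous.intervalIntegrable (by fun_prop) _ _) (fun θ hθ => ?_) hlt'
    exact pow_pos (Real.cos_pos_of_mem_Ioo hθ) _
  have hK := cosIntegral_two_mul_natCast N
  rw [← hAdef] at hK
  have hKne : cosIntegral ((2 * N : ℕ) : ℂ) 0 ≠ 0 := by rw [hK]; exact_mod_cast hA.ne'
  rw [div_sub_one hKne, norm_div, hK, Complex.norm_real, Real.norm_eq_abs, abs_of_pos hA,
    div_le_iff₀ hA, ← hK]
  have hN' : (0 : ℝ) < N := by exact_mod_cast hN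
  have c1 : Continuous fun θ : ℝ => (Real.cos θ : ℂ) ^ (p + (2 * N : ℕ)) :=
    continuous_cos_cpow (by simp; linarith)
  have c2 : Continuous fun θ : ℝ => (Real.cos θ : ℂ) ^ ((2 * N : ℕ) : ℂ) :=
    continuous_cos_cpow (by simpa using hN)
  have e : cosIntegral (p + 2 * N) u - cosIntegral ((2 * N : ℕ) : ℂ) 0 =
      ∫ θ in -(Real.pi / 2)..Real.pi / 2,
        ((Real.cos θ : ℂ) ^ (p + (2 * N : ℕ)) * Complex.exp (Complex.I * u * θ) -
        (Real.cos θ : ℂ) ^ ((2 * N : ℕ) : ℂ)) := by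
    rw [intervalIntegral.integral_sub (Continuous.intervalIntegrable (by fun_prop) _ _)
      (Continuous.intervalIntegrable (by fun_prop) _ _)]
    simp [cosIntegral]
  rw [e]
  calc _ ≤ ∫ θ in -(Real.pi / 2)..Real.pi / 2,
        M * (Real.cos θ ^ (2 * N - 1) * |Real.sin θ|) := by
        refine intervalIntegral.norm_integral_le_of_norm_le hlt ?_
          (Continuous.intervalIntegrable (by fun_prop) _ _)
        exact Eventually.of_forall fun θ hθ => hb N hN θ ⟨hθ.1.le, hθ.2⟩
    _ ≤ M * (A / √(2 * N - 1)) := by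
        rw [intervalIntegral.integral_const_mul]
        exact mul_le_mul_of_nonneg_left (integral_cos_pow_mul_abs_sin_le N hN) hM
    _ = _ := by ring

theorem cosIntegral_zero_zero : cosIntegral 0 0 = Real.pi := by
  simp [cosIntegral]

/-- The recurrence is iterated for `(p, u)` and for `(0, 0)`, where the integral is `π`. In the
quotient, the unknown growth of the integral of `cos θ ^ (2N)` cancels, and Legendre's duplication
formula tidies the result. -/
theorem cosIntegral_eq {p : ℂ} (hp : 0 < p.re) (u : ℂ) :
    cosIntegral p u = Real.pi * (Complex.Gamma (p + 1) * 2 ^ (-p)) /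
      (Complex.Gamma (1 + (p + u) / 2) * Complex.Gamma (1 + (p - u) / 2)) := by
  have hpi : (√Real.pi : ℂ) ≠ 0 := by
    exact_mod_cast (Real.sqrt_pos.2 Real.pi_pos).ne'
  have hdup : Complex.Gamma ((p + 1) / 2) * Complex.Gamma ((p + 2) / 2) =
      Complex.Gamma (p + 1) * 2 ^ (-p) * √Real.pi := by
    have := Complex.Gamma_mul_Gamma_add_half ((p + 1) / 2)
    rw [show (p + 1) / 2 + 1 / 2 = (p + 2) / 2 by ring, show 2 * ((p + 1) / 2) = p + 1 by ring,
      show 1 - (p + 1) = -p by ring] at this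
    exact this
  have h0 : Tendsto (fun N : ℕ => cosFactor 0 0 N / (N : ℂ) ^ (1 / 2 : ℂ)) atTop
      (𝓝 (√Real.pi : ℂ)) := by
    have := tendsto_cosFactor_div (p := 0) (by simp) 0
    have e : (Real.pi : ℂ) ^ (1 / 2 : ℂ) = (√Real.pi : ℂ) := by
      rw [Real.sqrt_eq_rpow, Complex.ofReal_cpow Real.pi_pos.le]; norm_num
    have hG : Complex.Gamma 2⁻¹ = (√Real.pi : ℂ) := by
      rw [← one_div, Complex.Gamma_one_half_eq, e]
    simpa [hG] using this
  have h1 := ((tendsto_cosFactor_div hp.le u).mul (tendsto_cosIntegral_div hp.le u)).div h0 hpi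
  have hconst : ∀ᶠ N : ℕ in atTop, cosFactor p u N / (N : ℂ) ^ (1 / 2 : ℂ) *
      (cosIntegral (p + 2 * N) u / cosIntegral ((2 * N : ℕ) : ℂ) 0) /
      (cosFactor 0 0 N / (N : ℂ) ^ (1 / 2 : ℂ)) = cosIntegral p u / Real.pi := by
    filter_upwards [eventually_gt_atTop 0] with N hN
    have hN0 : (N : ℂ) ≠ 0 := by exact_mod_cast hN.ne'
    have k := natCast_cpow_ne_zero hN0 (1 / 2)
    have e1 := cosIntegral_eq_cosFactor_mul (Or.inl hp) u N
    have e2 := cosIntegral_eq_cosFactor_mul (p := 0) (Or.inr rfl) 0 N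
    rw [cosIntegral_zero_zero] at e2
    have hpi' : (Real.pi : ℂ) ≠ 0 := by exact_mod_cast Real.pi_ne_zero
    have n1 : cosFactor 0 0 N ≠ 0 := fun h => hpi' (by rw [e2, h, zero_mul])
    have n2 : cosIntegral (0 + 2 * N) 0 ≠ 0 := fun h => hpi' (by rw [e2, h, mul_zero])
    rw [e1, e2, show ((2 * N : ℕ) : ℂ) = 0 + 2 * N by push_cast; ring]
    field_simp
  have h2 := tendsto_nhds_unique (tendsto_const_nhds.congr' (hconst.mono fun _ h => h.symm)) h1
  have hpi' : (Real.pi : ℂ) ≠ 0 := by exact_mod_cast Real.pi_ne_zero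
  rw [hdup, div_eq_iff hpi'] at h2
  rw [h2]
  field_simp

/-! ### Fourier series and Dougall's bilateral sum -/

theorem summable_one_add_abs_int_rpow {r : ℝ} (hr : r < -1) :
    Summable fun n : ℤ => (1 + |(n : ℝ)|) ^ r := by
  have h := Real.summable_abs_int_rpow (b := -r) (by linarith)
  rw [neg_neg] at h
  refine Summable.of_norm_bounded_eventually h ?_
  have : ∀ᶠ n : ℤ in cofinite, n ≠ 0 := by
    simpa using (Set.finite_singleton (0 : ℤ)).compl_mem_cofinite
  filter_upwards [this] with n hn
  rw [Real.norm_of_nonneg (by positivity)]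
  exact Real.rpow_le_rpow_of_nonpos (abs_pos.2 (by exact_mod_cast hn)) (by linarith) (by linarith)

theorem hasSum_fourier_cos {p : ℂ} (hp : 0 < p.re) (u : ℂ)
    (hs : Summable fun n : ℤ => cosIntegral p (u - 2 * n)) {θ : ℝ}
    (hθ : θ ∈ Set.Ico (-(Real.pi / 2)) (Real.pi / 2)) :
    HasSum (fun n : ℤ => 1 / Real.pi * cosIntegral p (u - 2 * n) * Complex.exp (Complex.I * (2 * n) * θ))
      ((Real.cos θ : ℂ) ^ p * Complex.exp (Complex.I * u * θ)) := by
  have : Fact (0 < Real.pi) := ⟨Real.pi_pos⟩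
  set f : ℝ → ℂ := fun θ => (Real.cos θ : ℂ) ^ p * Complex.exp (Complex.I * u * θ) with hf
  have hp0 : p ≠ 0 := fun h => by simp [h] at hp
  have hend : -(Real.pi / 2) + Real.pi = Real.pi / 2 := by ring
  have hpi : (Real.pi : ℂ) ≠ 0 := by exact_mod_cast Real.pi_ne_zero
  have hcont : Continuous f := (continuous_cos_cpow hp).mul (by fun_prop)
  -- The exponential need not have period `π`; continuity on the circle comes from `cos θ ^ p`
  -- vanishing at both ends.
  have hF : Continuous (AddCircle.liftIco Real.pi (-(Real.pi / 2)) f) := by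
    refine AddCircle.liftIco_continuous ?_ hcont.continuousOn
    rw [hend]
    simp [hf, Complex.zero_cpow hp0]
  have hcoef (n : ℤ) : fourierCoeff (AddCircle.liftIco Real.pi (-(Real.pi / 2)) f) n =
      1 / Real.pi * cosIntegral p (u - 2 * n) := by
    rw [fourierCoeff_liftIco_eq, fourierCoeffOn_eq_integral, cosIntegral, hend]
    have : Real.pi / 2 - -(Real.pi / 2) = Real.pi := by ring
    rw [this, Complex.real_smul]
    push_cast
    congr 1
    refine intervalIntegral.integral_congr fun t _ => ?_
    simp only [smul_eq_mul, hf]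
    rw [fourier_coe_apply, mul_left_comm, ← Complex.exp_add]
    rw [← Complex.ofReal_cos]
    refine congrArg (fun z => (Real.cos t : ℂ) ^ p * Complex.exp z) ?_
    push_cast
    field_simp
    ring
  have hsum := has_pointwise_sum_fourier_series_of_summable
    (f := ⟨AddCircle.liftIco Real.pi (-(Real.pi / 2)) f, hF⟩)
    ((hs.mul_left (1 / (Real.pi : ℂ))).congr fun n => (hcoef n).symm) (θ : AddCircle Real.pi)
  simp only [ContinuousMap.coe_mk, hcoef, smul_eq_mul] at hsum
  rw [AddCircle.liftIco_coe_apply (by rwa [hend])] at hsum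
  convert hsum using 2 with n
  rw [fourier_coe_apply]
  congr 2
  field_simp

/-- A Parseval identity: the Fourier series of the first function is multiplied by the second and
integrated term by term. -/
theorem hasSum_cosIntegral_mul {p q : ℂ} (hp : 0 < p.re) (hq : 0 < q.re) (u v : ℂ)
    (hs : Summable fun n : ℤ => cosIntegral p (u - 2 * n)) :
    HasSum (fun n : ℤ => cosIntegral p (u - 2 * n) * cosIntegral q (v + 2 * n))
      (Real.pi * cosIntegral (p + q) (u + v)) := by
  have hpi : (Real.pi : ℂ) ≠ 0 := by exact_mod_cast Real.pi_ne_zero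
  have hlt : -(Real.pi / 2) < Real.pi / 2 := by linarith [Real.pi_pos]
  set g : ℝ → ℂ := fun θ => (Real.cos θ : ℂ) ^ q * Complex.exp (Complex.I * v * θ) with hg
  have hgc : Continuous g := (continuous_cos_cpow hq).mul (by fun_prop)
  have hs' : Summable fun n : ℤ => ‖1 / (Real.pi : ℂ) * cosIntegral p (u - 2 * n)‖ :=
    (hs.mul_left _).norm
  have key := intervalIntegral.hasSum_integral_of_dominated_convergence
    (a := -(Real.pi / 2)) (b := Real.pi / 2) (μ := MeasureTheory.volume)
    (F := fun (n : ℤ) (θ : ℝ) => 1 / Real.pi * cosIntegral p (u - 2 * n) *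
      Complex.exp (Complex.I * (2 * n) * θ) * g θ)
    (f := fun θ => ((Real.cos θ : ℂ) ^ p * Complex.exp (Complex.I * u * θ)) * g θ)
    (fun n θ => ‖1 / (Real.pi : ℂ) * cosIntegral p (u - 2 * n)‖ * ‖g θ‖)
    (fun n => Continuous.aestronglyMeasurable (by fun_prop))
    (fun n => Eventually.of_forall fun θ _ => by
      have : ‖Complex.exp (Complex.I * (2 * n) * θ)‖ = 1 := by
        rw [Complex.norm_exp]; simp
      rw [norm_mul, norm_mul, this, mul_one])
    (Eventually.of_forall fun θ _ => hs'.mul_right _)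
    (by
      simp only [tsum_mul_right]
      exact Continuous.intervalIntegrable (by fun_prop) _ _)
    (by
      have h0 : ∀ᵐ θ : ℝ, θ ≠ Real.pi / 2 := by
        simp [MeasureTheory.ae_iff]
      filter_upwards [h0] with θ hθ hmem
      rw [Set.uIoc_of_le hlt.le] at hmem
      exact (hasSum_fourier_cos hp u hs ⟨hmem.1.le, hmem.2.lt_of_ne hθ⟩).mul_right _)
  have e1 : ∫ θ : ℝ in -(Real.pi / 2)..Real.pi / 2,
      ((Real.cos θ : ℂ) ^ p * Complex.exp (Complex.I * u * θ)) * g θ =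
      cosIntegral (p + q) (u + v) := by
    rw [cosIntegral]
    refine intervalIntegral.integral_congr_Ioo_of_le hlt.le fun θ hθ => ?_
    have hc : (Real.cos θ : ℂ) ≠ 0 := by exact_mod_cast (Real.cos_pos_of_mem_Ioo hθ).ne'
    simp only [hg]
    rw [Complex.cpow_add _ _ hc, mul_mul_mul_comm, ← Complex.exp_add]
    congr 2; ring
  have e2 (n : ℤ) : ∫ θ : ℝ in -(Real.pi / 2)..Real.pi / 2,
      1 / Real.pi * cosIntegral p (u - 2 * n) * Complex.exp (Complex.I * (2 * n) * θ) * g θ =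
      1 / Real.pi * cosIntegral p (u - 2 * n) * cosIntegral q (v + 2 * n) := by
    rw [cosIntegral.eq_1 q, ← intervalIntegral.integral_const_mul]
    refine intervalIntegral.integral_congr fun θ _ => ?_
    simp only [hg]
    have : Complex.exp (Complex.I * (v + 2 * n) * θ) =
        Complex.exp (Complex.I * (2 * n) * θ) * Complex.exp (Complex.I * v * θ) := by
      rw [← Complex.exp_add]; congr 1; ring
    rw [this]; ring
  rw [e1] at key
  simp only [e2] at key
  refine (key.mul_left (Real.pi : ℂ)).congr_fun fun n => ?_
  field_simp

/-- Cauchy's beta integral expressed through a quotient of Gamma functions. -/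
theorem cosIntegral_eq_gammaRatio {a b : ℂ} (ha : ∀ k : ℤ, a ≠ k)
    (hab : 1 < (b - a).re) (n : ℤ) :
    cosIntegral (b - a - 1) (1 - a - b - 2 * n) =
      Complex.Gamma (b - a) * 2 ^ (1 + a - b) * Complex.sin (Real.pi * a) * (-1) ^ n *
        gammaRatio a b n := by
  have hs := sin_pi_mul_ne_zero ha
  rw [cosIntegral_eq (by simpa using hab), gammaRatio]
  have h := Gamma_sub_int ha (-n)
  have e1 : a - ((-n : ℤ) : ℂ) = a + n := by push_cast; ring
  rw [e1] at h
  rw [h, show b - a - 1 + 1 = b - a by ring, show -(b - a - 1) = 1 + a - b by ring,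
    show 1 + (b - a - 1 + (1 - a - b - 2 * n)) / 2 = 1 - a + ((-n : ℤ) : ℂ) by push_cast; ring,
    show 1 + (b - a - 1 - (1 - a - b - 2 * n)) / 2 = b + n by ring]
  have h1 : ((-1 : ℂ) ^ n) * (-1) ^ (-n) = 1 := by
    rw [← zpow_add₀ (by norm_num)]; simp
  have h2 := mul_inv_cancel₀ hs
  simp only [div_eq_mul_inv, mul_inv]
  linear_combination (-(Real.pi * Complex.Gamma (b - a) * 2 ^ (1 + a - b) *
    (Complex.Gamma (1 - a + ((-n : ℤ) : ℂ)))⁻¹ * (Complex.Gamma (b + n))⁻¹)) *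
    (Complex.sin (Real.pi * a) * (Complex.sin (Real.pi * a))⁻¹ * h1 + h2)

theorem cosIntegral_neg {p : ℂ} (hp : 0 < p.re) (u : ℂ) :
    cosIntegral p (-u) = cosIntegral p u := by
  rw [cosIntegral_eq hp, cosIntegral_eq hp, sub_neg_eq_add, ← sub_eq_add_neg,
    mul_comm (Complex.Gamma (1 + (p - u) / 2))]

theorem summable_gammaRatio {a b : ℂ} (ha : ∀ k : ℤ, a ≠ k) (hb : ∀ k : ℤ, b ≠ k)
    (hab : 1 < (b - a).re) : Summable (gammaRatio a b) := by
  obtain ⟨C, -, hC⟩ := exists_norm_gammaRatio_le ha hb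
  refine Summable.of_norm_bounded ((summable_one_add_abs_int_rpow ?_).mul_left C) hC
  simp at hab
  linarith

/-- Dougall's bilateral sum, in the range where both ratios decay. -/
theorem hasSum_gammaRatio_mul_gammaRatio {a b c d : ℂ} (ha : ∀ k : ℤ, a ≠ k) (hb : ∀ k : ℤ, b ≠ k)
    (hc : ∀ k : ℤ, c ≠ k) (hab : 1 < (b - a).re) (hcd : 1 < (d - c).re) :
    HasSum (fun n : ℤ => gammaRatio a b n * gammaRatio c d n)
      (Real.pi ^ 2 / (Complex.sin (Real.pi * a) * Complex.sin (Real.pi * c)) *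
        (Complex.Gamma (b + d - a - c - 1) / (Complex.Gamma (b - a) * Complex.Gamma (d - c) *
          Complex.Gamma (d - a) * Complex.Gamma (b - c)))) := by
  have h2 (z : ℂ) : (2 : ℂ) ^ z ≠ 0 := fun h => two_ne_zero ((Complex.cpow_eq_zero_iff _ _).1 h).1
  have hp : 0 < (b - a - 1).re := by simpa using hab
  have hq : 0 < (d - c - 1).re := by simpa using hcd
  have hsgn (n : ℤ) : ((-1 : ℂ) ^ n) * (-1) ^ n = 1 := by rw [← mul_zpow]; simp
  have hsum : Summable fun n : ℤ => cosIntegral (b - a - 1) (1 - a - b - 2 * n) := by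
    refine Summable.of_norm ?_
    have h := (summable_gammaRatio ha hb hab).norm.mul_left
      ‖Complex.Gamma (b - a) * 2 ^ (1 + a - b) * Complex.sin (Real.pi * a)‖
    refine h.congr fun n => ?_
    rw [cosIntegral_eq_gammaRatio ha hab, norm_mul _ (gammaRatio a b n), norm_mul _ ((-1 : ℂ) ^ n)]
    simp
  have key := hasSum_cosIntegral_mul hp hq (1 - a - b) (c + d - 1) hsum
  -- Evenness in `u` brings the second factor to the form with `-2n`; the two signs `(-1)^n` then
  -- cancel.
  have e (n : ℤ) : cosIntegral (d - c - 1) (c + d - 1 + 2 * n) =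
      cosIntegral (d - c - 1) (1 - c - d - 2 * n) := by
    rw [← cosIntegral_neg hq]; congr 1; ring
  simp only [e, cosIntegral_eq_gammaRatio ha hab, cosIntegral_eq_gammaRatio hc hcd] at key
  rw [cosIntegral_eq (by simp at hp hq ⊢; linarith),
    show 1 + (b - a - 1 + (d - c - 1) + (1 - a - b + (c + d - 1))) / 2 = d - a by ring,
    show 1 + (b - a - 1 + (d - c - 1) - (1 - a - b + (c + d - 1))) / 2 = b - c by ring,
    show b - a - 1 + (d - c - 1) + 1 = b + d - a - c - 1 by ring,
    show -(b - a - 1 + (d - c - 1)) = (1 + a - b) + (1 + c - d) by ring,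
    Complex.cpow_add _ _ two_ne_zero] at key
  have s1 := sin_pi_mul_ne_zero ha
  have s2 := sin_pi_mul_ne_zero hc
  have g1 : Complex.Gamma (b - a) ≠ 0 :=
    Complex.Gamma_ne_zero_of_re_pos (by linarith)
  have g2 : Complex.Gamma (d - c) ≠ 0 :=
    Complex.Gamma_ne_zero_of_re_pos (by linarith)
  have t1 := h2 (1 + a - b)
  have t2 := h2 (1 + c - d)
  generalize (2 : ℂ) ^ (1 + a - b) = T at *
  generalize (2 : ℂ) ^ (1 + c - d) = U at *
  have key' := key.mul_left (Complex.Gamma (b - a) * T * Complex.sin (Real.pi * a) *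
    (Complex.Gamma (d - c) * U * Complex.sin (Real.pi * c)))⁻¹
  have hval : (Complex.Gamma (b - a) * T * Complex.sin (Real.pi * a) *
      (Complex.Gamma (d - c) * U * Complex.sin (Real.pi * c)))⁻¹ *
      (Real.pi * (Real.pi * (Complex.Gamma (b + d - a - c - 1) * (T * U)) /
        (Complex.Gamma (d - a) * Complex.Gamma (b - c)))) =
      Real.pi ^ 2 / (Complex.sin (Real.pi * a) * Complex.sin (Real.pi * c)) *
        (Complex.Gamma (b + d - a - c - 1) / (Complex.Gamma (b - a) * Complex.Gamma (d - c) *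
          Complex.Gamma (d - a) * Complex.Gamma (b - c))) := by
    have q1 := mul_inv_cancel₀ t1
    have q2 := mul_inv_cancel₀ t2
    simp only [div_eq_mul_inv, mul_inv]
    linear_combination (Real.pi ^ 2 * Complex.Gamma (b + d - a - c - 1) *
      (Complex.Gamma (d - a))⁻¹ * (Complex.Gamma (b - c))⁻¹ * (Complex.Gamma (b - a))⁻¹ *
      (Complex.Gamma (d - c))⁻¹ * (Complex.sin (Real.pi * a))⁻¹ * (Complex.sin (Real.pi * c))⁻¹) *
      (U * U⁻¹ * q1 + q2)
  rw [hval] at key'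
  refine key'.congr_fun fun n => ?_
  have s1' := mul_inv_cancel₀ (mul_ne_zero (mul_ne_zero (mul_ne_zero g1 t1) s1)
    (mul_ne_zero (mul_ne_zero g2 t2) s2))
  linear_combination -(gammaRatio a b n * gammaRatio c d n) * (((-1 : ℂ) ^ n * (-1) ^ n) * s1' + hsgn n)

/-! ### Balanced series: decay, reflection symmetry and contiguous relations -/

/-- The Saalschütz and periodicity conditions in coordinates, all parameters being non-integral. -/
structure Balanced (x₁ x₂ x₃ y₁ y₂ y₃ : ℂ) : Prop where
  hx₁ : ∀ k : ℤ, x₁ ≠ k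
  hx₂ : ∀ k : ℤ, x₂ ≠ k
  hx₃ : ∀ k : ℤ, x₃ ≠ k
  hy₁ : ∀ k : ℤ, y₁ ≠ k
  hy₂ : ∀ k : ℤ, y₂ ≠ k
  hy₃ : ∀ k : ℤ, y₃ ≠ k
  sum_eq : x₁ + x₂ + x₃ + 2 = y₁ + y₂ + y₃
  sin_eq : Complex.sin (Real.pi * x₁) * Complex.sin (Real.pi * x₂) * Complex.sin (Real.pi * x₃) =
    Complex.sin (Real.pi * y₁) * Complex.sin (Real.pi * y₂) * Complex.sin (Real.pi * y₃)

/-- The general term of the bilateral series in coordinates. -/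
noncomputable def bterm (x₁ x₂ x₃ y₁ y₂ y₃ : ℂ) (n : ℤ) : ℂ :=
  gammaRatio x₁ y₁ n * gammaRatio x₂ y₂ n * gammaRatio x₃ y₃ n

variable {x₁ x₂ x₃ y₁ y₂ y₃ : ℂ}

theorem sin_pi_mul_one_sub (a : ℂ) : Complex.sin (Real.pi * (1 - a)) = Complex.sin (Real.pi * a) := by
  rw [mul_sub, mul_one, Complex.sin_pi_sub]

theorem Balanced.reflect (h : Balanced x₁ x₂ x₃ y₁ y₂ y₃) :
    Balanced (1 - y₁) (1 - y₂) (1 - y₃) (1 - x₁) (1 - x₂) (1 - x₃) where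
  hx₁ := one_sub_ne_int h.hy₁
  hx₂ := one_sub_ne_int h.hy₂
  hx₃ := one_sub_ne_int h.hy₃
  hy₁ := one_sub_ne_int h.hx₁
  hy₂ := one_sub_ne_int h.hx₂
  hy₃ := one_sub_ne_int h.hx₃
  sum_eq := by linear_combination h.sum_eq
  sin_eq := by simp only [sin_pi_mul_one_sub, h.sin_eq]

/-- The three reflections contribute a quotient of sines, which the periodicity condition makes
equal to `1`. -/
theorem Balanced.bterm_neg (h : Balanced x₁ x₂ x₃ y₁ y₂ y₃) (n : ℤ) :
    bterm x₁ x₂ x₃ y₁ y₂ y₃ (-n) = bterm (1 - y₁) (1 - y₂) (1 - y₃) (1 - x₁) (1 - x₂) (1 - x₃) n := by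
  have s1 := sin_pi_mul_ne_zero h.hx₁
  have s2 := sin_pi_mul_ne_zero h.hx₂
  have s3 := sin_pi_mul_ne_zero h.hx₃
  rw [bterm, bterm, gammaRatio_neg h.hx₁ h.hy₁, gammaRatio_neg h.hx₂ h.hy₂,
    gammaRatio_neg h.hx₃ h.hy₃]
  have e : Complex.sin (Real.pi * y₁) / Complex.sin (Real.pi * x₁) *
      (Complex.sin (Real.pi * y₂) / Complex.sin (Real.pi * x₂)) *
      (Complex.sin (Real.pi * y₃) / Complex.sin (Real.pi * x₃)) = 1 := by
    rw [div_mul_div_comm, div_mul_div_comm, ← h.sin_eq, div_self]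
    exact mul_ne_zero (mul_ne_zero s1 s2) s3
  linear_combination (gammaRatio (1 - y₁) (1 - x₁) n * gammaRatio (1 - y₂) (1 - x₂) n *
    gammaRatio (1 - y₃) (1 - x₃) n) * e

theorem Balanced.summable (h : Balanced x₁ x₂ x₃ y₁ y₂ y₃) :
    Summable (bterm x₁ x₂ x₃ y₁ y₂ y₃) := by
  obtain ⟨C₁, p₁, h₁⟩ := exists_norm_gammaRatio_le h.hx₁ h.hy₁
  obtain ⟨C₂, p₂, h₂⟩ := exists_norm_gammaRatio_le h.hx₂ h.hy₂
  obtain ⟨C₃, p₃, h₃⟩ := exists_norm_gammaRatio_le h.hx₃ h.hy₃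
  refine Summable.of_norm_bounded ((summable_one_add_abs_int_rpow (r := -2) (by norm_num)).mul_left
    (C₁ * C₂ * C₃)) fun n => ?_
  have hpos : 0 < 1 + |(n : ℝ)| := by positivity
  have hs := congrArg Complex.re h.sum_eq
  simp at hs
  have e : (1 + |(n : ℝ)|) ^ (-2 : ℝ) = (1 + |(n : ℝ)|) ^ (x₁.re - y₁.re) *
      (1 + |(n : ℝ)|) ^ (x₂.re - y₂.re) * (1 + |(n : ℝ)|) ^ (x₃.re - y₃.re) := by
    rw [← Real.rpow_add hpos, ← Real.rpow_add hpos]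
    congr 1; linarith
  rw [bterm, norm_mul, norm_mul, e]
  calc _ ≤ (C₁ * (1 + |(n : ℝ)|) ^ (x₁.re - y₁.re)) * (C₂ * (1 + |(n : ℝ)|) ^ (x₂.re - y₂.re)) *
        (C₃ * (1 + |(n : ℝ)|) ^ (x₃.re - y₃.re)) := by
        gcongr
        · exact h₁ n
        · exact h₂ n
        · exact h₃ n
    _ = _ := by ring

theorem Balanced.tendsto_natCast (h : Balanced x₁ x₂ x₃ y₁ y₂ y₃) (a b : ℂ) :
    Tendsto (fun n : ℕ => (a + n) * (b + n) * bterm x₁ x₂ x₃ y₁ y₂ y₃ n) atTop (𝓝 1) := by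
  have ht := ((tendsto_gammaRatio_mul_cpow x₁ y₁).mul (tendsto_gammaRatio_mul_cpow x₂ y₂)).mul
    (tendsto_gammaRatio_mul_cpow x₃ y₃)
  have ha := (tendsto_natCast_div_add_natCast a).inv₀ one_ne_zero
  have hb := (tendsto_natCast_div_add_natCast b).inv₀ one_ne_zero
  have := (ha.mul hb).mul ht
  simp only [inv_one, one_mul] at this
  refine this.congr' ?_
  filter_upwards [eventually_gt_atTop 0] with n hn
  have hn0 : (n : ℂ) ≠ 0 := by exact_mod_cast hn.ne'
  have e : (n : ℂ) ^ (y₁ - x₁) * (n : ℂ) ^ (y₂ - x₂) * (n : ℂ) ^ (y₃ - x₃) = (n : ℂ) ^ 2 := by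
    rw [← Complex.cpow_add _ _ hn0, ← Complex.cpow_add _ _ hn0, ← Complex.cpow_natCast]
    congr 1
    push_cast
    linear_combination -h.sum_eq
  have e2 := inv_mul_cancel₀ (pow_ne_zero 2 hn0)
  rw [inv_div, inv_div, bterm]
  simp only [div_eq_mul_inv]
  linear_combination ((a + n) * (n : ℂ)⁻¹ * ((b + n) * (n : ℂ)⁻¹) * gammaRatio x₁ y₁ n *
    gammaRatio x₂ y₂ n * gammaRatio x₃ y₃ n) * e + ((a + n) * (b + n) * gammaRatio x₁ y₁ n *
    gammaRatio x₂ y₂ n * gammaRatio x₃ y₃ n) * e2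

theorem Balanced.tendsto_neg_natCast (h : Balanced x₁ x₂ x₃ y₁ y₂ y₃) (a b : ℂ) :
    Tendsto (fun n : ℕ => (a - n) * (b - n) * bterm x₁ x₂ x₃ y₁ y₂ y₃ (-n)) atTop (𝓝 1) := by
  refine (h.reflect.tendsto_natCast (-a) (-b)).congr fun n => ?_
  rw [h.bterm_neg]; ring

/-- Only equality of the two boundary limits matters: in the applications they need not vanish. -/
theorem tsum_int_sub_eq_zero {f g : ℤ → ℂ} {l : ℂ} (hf : Summable f)
    (hfg : ∀ n, f n = g (n + 1) - g n) (h₁ : Tendsto (fun n : ℕ => g n) atTop (𝓝 l))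
    (h₂ : Tendsto (fun n : ℕ => g (-n)) atTop (𝓝 l)) : ∑' n, f n = 0 := by
  have s1 : Summable fun n : ℕ => f n := hf.comp_injective Nat.cast_injective
  have s2 : Summable fun n : ℕ => f (-(n + 1 : ℤ)) :=
    hf.comp_injective (i := fun n : ℕ => (-(n + 1 : ℤ))) fun a b hab => by simpa using hab
  have t1 : ∑' n : ℕ, f n = l - g 0 := by
    refine tendsto_nhds_unique s1.hasSum.tendsto_sum_nat ((h₁.sub_const (g 0)).congr fun N => ?_)
    simp only [hfg]
    exact_mod_cast (Finset.sum_range_sub (fun n : ℕ => g n) N).symm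
  have t2 : ∑' n : ℕ, f (-(n + 1 : ℤ)) = g 0 - l := by
    refine tendsto_nhds_unique s2.hasSum.tendsto_sum_nat ((h₂.const_sub (g 0)).congr fun N => ?_)
    have e (n : ℕ) : f (-(n + 1 : ℤ)) = g (-(n : ℤ)) - g (-((n + 1 : ℕ) : ℤ)) := by
      rw [hfg]; congr 2; ring
    simp only [e]
    simpa using (Finset.sum_range_sub' (fun n : ℕ => g (-n)) N).symm
  rw [tsum_of_nat_of_neg_add_one s1 s2, t1, t2]
  ring

theorem gammaRatio_add_one_add_one {a b : ℂ} (ha : ∀ k : ℤ, a ≠ k) (hb : ∀ k : ℤ, b ≠ k) (n : ℤ) :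
    gammaRatio (a + 1) (b + 1) n = gammaRatio a b n * ((a + n) / (b + n)) := by
  rw [← gammaRatio_add_one ha hb, gammaRatio, gammaRatio]
  push_cast
  rw [add_assoc, add_assoc, add_comm 1 (n : ℂ)]

theorem gammaRatio_right_add_one (a : ℂ) {b : ℂ} (hb : ∀ k : ℤ, b ≠ k) (n : ℤ) :
    gammaRatio a b n = gammaRatio a (b + 1) n * (b + n) := by
  have h := add_intCast_ne_zero hb n
  rw [gammaRatio, gammaRatio, show b + 1 + n = b + n + 1 by ring, Complex.Gamma_add_one _ h,
    div_mul_eq_mul_div, mul_comm (b + (n : ℂ)), mul_div_mul_right _ _ h]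

theorem add_one_ne_int {a : ℂ} (ha : ∀ k : ℤ, a ≠ k) : ∀ k : ℤ, a + 1 ≠ k := by
  simpa using add_intCast_ne_int ha 1

theorem sub_one_ne_int {a : ℂ} (ha : ∀ k : ℤ, a ≠ k) : ∀ k : ℤ, a - 1 ≠ k := by
  simpa [sub_eq_add_neg] using add_intCast_ne_int ha (-1)

theorem sin_pi_mul_add_one (a : ℂ) : Complex.sin (Real.pi * (a + 1)) = -Complex.sin (Real.pi * a) := by
  rw [mul_add, mul_one, Complex.sin_add_pi]

theorem sin_pi_mul_sub_one (a : ℂ) : Complex.sin (Real.pi * (a - 1)) = -Complex.sin (Real.pi * a) := by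
  rw [mul_sub, mul_one, Complex.sin_sub_pi]

theorem Balanced.shift_pair (h : Balanced x₁ x₂ x₃ y₁ y₂ y₃) :
    Balanced (x₁ + 1) x₂ x₃ (y₁ + 1) y₂ y₃ where
  __ := h
  hx₁ := add_one_ne_int h.hx₁
  hy₁ := add_one_ne_int h.hy₁
  sum_eq := by linear_combination h.sum_eq
  sin_eq := by
    rw [sin_pi_mul_add_one, sin_pi_mul_add_one]
    linear_combination -h.sin_eq

theorem Balanced.shift_lower (h : Balanced x₁ x₂ x₃ y₁ y₂ y₃) :
    Balanced x₁ x₂ x₃ (y₁ - 1) (y₂ + 1) y₃ where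
  __ := h
  hy₁ := sub_one_ne_int h.hy₁
  hy₂ := add_one_ne_int h.hy₂
  sum_eq := by linear_combination h.sum_eq
  sin_eq := by
    rw [sin_pi_mul_add_one, sin_pi_mul_sub_one]
    linear_combination h.sin_eq

theorem Balanced.tsum_shift_pair (h : Balanced x₁ x₂ x₃ y₁ y₂ y₃) :
    (y₁ - x₂) * (y₁ - x₃) * ∑' n, bterm (x₁ + 1) x₂ x₃ (y₁ + 1) y₂ y₃ n =
      (y₂ - x₁ - 1) * (y₃ - x₁ - 1) * ∑' n, bterm x₁ x₂ x₃ y₁ y₂ y₃ n := by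
  have s1 := h.shift_pair.summable.mul_left ((y₁ - x₂) * (y₁ - x₃))
  have s2 := h.summable.mul_left ((y₂ - x₁ - 1) * (y₃ - x₁ - 1))
  have := tsum_int_sub_eq_zero (s1.sub s2)
    -- The telescoping certificate: the two linear factors cancel the denominators `y₂ + n` and `y₃
    -- + n` in `g (n + 1)`, and being quadratic it tends to `1` at both ends.
    (g := fun n => (y₂ + n - 1) * (y₃ + n - 1) * bterm x₁ x₂ x₃ y₁ y₂ y₃ n) (fun n => by
      have d1 := add_intCast_ne_zero h.hy₁ n
      have d2 := add_intCast_ne_zero h.hy₂ n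
      have d3 := add_intCast_ne_zero h.hy₃ n
      simp only [bterm]
      rw [gammaRatio_add_one_add_one h.hx₁ h.hy₁, gammaRatio_add_one h.hx₁ h.hy₁,
        gammaRatio_add_one h.hx₂ h.hy₂, gammaRatio_add_one h.hx₃ h.hy₃]
      generalize gammaRatio x₁ y₁ n = G₁
      generalize gammaRatio x₂ y₂ n = G₂
      generalize gammaRatio x₃ y₃ n = G₃
      obtain rfl : y₃ = x₁ + x₂ + x₃ + 2 - y₁ - y₂ := by linear_combination -h.sum_eq
      push_cast
      field_simp
      ring)
    ((h.tendsto_natCast (y₂ - 1) (y₃ - 1)).congr fun n => by push_cast; ring)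
    ((h.tendsto_neg_natCast (y₂ - 1) (y₃ - 1)).congr fun n => by push_cast; ring)
  rw [s1.tsum_sub s2, tsum_mul_left, tsum_mul_left] at this
  exact sub_eq_zero.1 this

theorem Balanced.tsum_shift_lower (h : Balanced x₁ x₂ x₃ y₁ y₂ y₃) :
    (x₁ - y₂) * (x₂ - y₂) * (x₃ - y₂) * ∑' n, bterm x₁ x₂ x₃ (y₁ - 1) (y₂ + 1) y₃ n =
      (x₁ + 1 - y₁) * (x₂ + 1 - y₁) * (x₃ + 1 - y₁) * ∑' n, bterm x₁ x₂ x₃ y₁ y₂ y₃ n := by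
  have s1 := h.shift_lower.summable.mul_left ((x₁ - y₂) * (x₂ - y₂) * (x₃ - y₂))
  have s2 := h.summable.mul_left ((x₁ + 1 - y₁) * (x₂ + 1 - y₁) * (x₃ + 1 - y₁))
  have := tsum_int_sub_eq_zero (s1.sub s2)
    (g := fun n => (y₁ - y₂ - 1) * ((y₁ + n - 1) * (y₃ + n - 1) * bterm x₁ x₂ x₃ y₁ y₂ y₃ n))
    (fun n => by
      have d1 := add_intCast_ne_zero h.hy₁ n
      have d2 := add_intCast_ne_zero h.hy₂ n
      have d3 := add_intCast_ne_zero h.hy₃ n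
      have r1 := gammaRatio_right_add_one x₁ (sub_one_ne_int h.hy₁) n
      rw [sub_add_cancel] at r1
      simp only [bterm]
      rw [gammaRatio_add_one h.hx₁ h.hy₁, gammaRatio_add_one h.hx₂ h.hy₂,
        gammaRatio_add_one h.hx₃ h.hy₃, r1, gammaRatio_right_add_one x₂ h.hy₂]
      generalize gammaRatio x₁ y₁ n = G₁
      generalize gammaRatio x₂ (y₂ + 1) n = G₂
      generalize gammaRatio x₃ y₃ n = G₃
      obtain rfl : y₃ = x₁ + x₂ + x₃ + 2 - y₁ - y₂ := by linear_combination -h.sum_eq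
      push_cast
      field_simp
      ring)
    (((h.tendsto_natCast (y₁ - 1) (y₃ - 1)).const_mul (y₁ - y₂ - 1)).congr fun n => by
      push_cast; ring)
    (((h.tendsto_neg_natCast (y₁ - 1) (y₃ - 1)).const_mul (y₁ - y₂ - 1)).congr fun n => by
      push_cast; ring)
  rw [s1.tsum_sub s2, tsum_mul_left, tsum_mul_left] at this
  exact sub_eq_zero.1 this

/-! ### The closed form and its recurrence -/

/-- No difference of a lower and an upper parameter is an integer. -/
structure Separated (x₁ x₂ x₃ y₁ y₂ y₃ : ℂ) : Prop where
  h₁₁ : ∀ k : ℤ, y₁ - x₁ ≠ k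
  h₁₂ : ∀ k : ℤ, y₁ - x₂ ≠ k
  h₁₃ : ∀ k : ℤ, y₁ - x₃ ≠ k
  h₂₁ : ∀ k : ℤ, y₂ - x₁ ≠ k
  h₂₂ : ∀ k : ℤ, y₂ - x₂ ≠ k
  h₂₃ : ∀ k : ℤ, y₂ - x₃ ≠ k
  h₃₁ : ∀ k : ℤ, y₃ - x₁ ≠ k
  h₃₂ : ∀ k : ℤ, y₃ - x₂ ≠ k
  h₃₃ : ∀ k : ℤ, y₃ - x₃ ≠ k

/-- The closed form in coordinates. -/
noncomputable def closedValue (x₁ x₂ x₃ y₁ y₂ y₃ : ℂ) : ℂ :=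
  (Real.pi : ℂ) ^ 5 / (Complex.sin (Real.pi * x₂) * Complex.sin (Real.pi * x₃) *
    (Complex.sin (Real.pi * (y₁ - x₁)) * Complex.sin (Real.pi * (y₂ - x₁)) *
      Complex.sin (Real.pi * (y₃ - x₁)))) /
  ((Complex.Gamma (y₁ - x₁) * Complex.Gamma (y₁ - x₂) * Complex.Gamma (y₁ - x₃)) *
    (Complex.Gamma (y₂ - x₁) * Complex.Gamma (y₂ - x₂) * Complex.Gamma (y₂ - x₃)) *
    (Complex.Gamma (y₃ - x₁) * Complex.Gamma (y₃ - x₂) * Complex.Gamma (y₃ - x₃)))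

theorem Balanced.swap (h : Balanced x₁ x₂ x₃ y₁ y₂ y₃) : Balanced x₁ x₃ x₂ y₁ y₃ y₂ where
  hx₁ := h.hx₁
  hx₂ := h.hx₃
  hx₃ := h.hx₂
  hy₁ := h.hy₁
  hy₂ := h.hy₃
  hy₃ := h.hy₂
  sum_eq := by linear_combination h.sum_eq
  sin_eq := by linear_combination h.sin_eq

theorem Separated.swap (h : Separated x₁ x₂ x₃ y₁ y₂ y₃) : Separated x₁ x₃ x₂ y₁ y₃ y₂ :=
  ⟨h.h₁₁, h.h₁₃, h.h₁₂, h.h₃₁, h.h₃₃, h.h₃₂, h.h₂₁, h.h₂₃, h.h₂₂⟩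

theorem closedValue_swap : closedValue x₁ x₃ x₂ y₁ y₃ y₂ = closedValue x₁ x₂ x₃ y₁ y₂ y₃ := by
  rw [closedValue, closedValue]
  congr 1
  · congr 1; ring
  · ring

theorem bterm_swap : bterm x₁ x₃ x₂ y₁ y₃ y₂ = bterm x₁ x₂ x₃ y₁ y₂ y₃ := by
  funext n; rw [bterm, bterm]; ring

theorem Separated.shift_lower (h : Separated x₁ x₂ x₃ y₁ y₂ y₃) :
    Separated x₁ x₂ x₃ (y₁ - 1) (y₂ + 1) y₃ where
  __ := h
  h₁₁ := by rw [sub_right_comm]; exact sub_one_ne_int h.h₁₁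
  h₁₂ := by rw [sub_right_comm]; exact sub_one_ne_int h.h₁₂
  h₁₃ := by rw [sub_right_comm]; exact sub_one_ne_int h.h₁₃
  h₂₁ := by rw [add_sub_right_comm]; exact add_one_ne_int h.h₂₁
  h₂₂ := by rw [add_sub_right_comm]; exact add_one_ne_int h.h₂₂
  h₂₃ := by rw [add_sub_right_comm]; exact add_one_ne_int h.h₂₃

theorem ne_zero_of_ne_int {a : ℂ} (ha : ∀ k : ℤ, a ≠ k) : a ≠ 0 := by simpa using ha 0

theorem Gamma_sub_of_lower_sub_one {x y : ℂ} (h : ∀ k : ℤ, y - x ≠ k) :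
    Complex.Gamma (y - x) = (y - 1 - x) * Complex.Gamma (y - 1 - x) := by
  have h' : y - 1 - x ≠ 0 := by rw [sub_right_comm]; exact ne_zero_of_ne_int (sub_one_ne_int h)
  rw [← Complex.Gamma_add_one _ h']; congr 1; ring

theorem Gamma_sub_of_lower_add_one {x y : ℂ} (h : ∀ k : ℤ, y - x ≠ k) :
    Complex.Gamma (y + 1 - x) = (y - x) * Complex.Gamma (y - x) := by
  rw [add_sub_right_comm, Complex.Gamma_add_one _ (ne_zero_of_ne_int h)]

theorem Separated.closedValue_shift_lower (h : Separated x₁ x₂ x₃ y₁ y₂ y₃) :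
    (x₁ - y₂) * (x₂ - y₂) * (x₃ - y₂) * closedValue x₁ x₂ x₃ (y₁ - 1) (y₂ + 1) y₃ =
      (x₁ + 1 - y₁) * (x₂ + 1 - y₁) * (x₃ + 1 - y₁) * closedValue x₁ x₂ x₃ y₁ y₂ y₃ := by
  have s1 : Complex.sin (Real.pi * (y₁ - 1 - x₁)) = -Complex.sin (Real.pi * (y₁ - x₁)) := by
    rw [sub_right_comm, sin_pi_mul_sub_one]
  have s2 : Complex.sin (Real.pi * (y₂ + 1 - x₁)) = -Complex.sin (Real.pi * (y₂ - x₁)) := by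
    rw [add_sub_right_comm, sin_pi_mul_add_one]
  rw [closedValue, closedValue, s1, s2, Gamma_sub_of_lower_sub_one h.h₁₁,
    Gamma_sub_of_lower_sub_one h.h₁₂, Gamma_sub_of_lower_sub_one h.h₁₃,
    Gamma_sub_of_lower_add_one h.h₂₁, Gamma_sub_of_lower_add_one h.h₂₂,
    Gamma_sub_of_lower_add_one h.h₂₃]
  have i1 := mul_inv_cancel₀ (ne_zero_of_ne_int h.h₂₁)
  have i2 := mul_inv_cancel₀ (ne_zero_of_ne_int h.h₂₂)
  have i3 := mul_inv_cancel₀ (ne_zero_of_ne_int h.h₂₃)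
  have j1 := mul_inv_cancel₀ (ne_zero_of_ne_int h.shift_lower.h₁₁)
  have j2 := mul_inv_cancel₀ (ne_zero_of_ne_int h.shift_lower.h₁₂)
  have j3 := mul_inv_cancel₀ (ne_zero_of_ne_int h.shift_lower.h₁₃)
  have hi : (x₁ - y₂) * (x₂ - y₂) * (x₃ - y₂) * ((y₂ - x₁)⁻¹ * (y₂ - x₂)⁻¹ * (y₂ - x₃)⁻¹) = -1 := by
    linear_combination -(y₂ - x₁) * (y₂ - x₁)⁻¹ * ((y₂ - x₂) * (y₂ - x₂)⁻¹) * i3 -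
      (y₂ - x₁) * (y₂ - x₁)⁻¹ * i2 - i1
  have hj : (x₁ + 1 - y₁) * (x₂ + 1 - y₁) * (x₃ + 1 - y₁) *
      ((y₁ - 1 - x₁)⁻¹ * (y₁ - 1 - x₂)⁻¹ * (y₁ - 1 - x₃)⁻¹) = -1 := by
    linear_combination -(y₁ - 1 - x₁) * (y₁ - 1 - x₁)⁻¹ * ((y₁ - 1 - x₂) * (y₁ - 1 - x₂)⁻¹) * j3 -
      (y₁ - 1 - x₁) * (y₁ - 1 - x₁)⁻¹ * j2 - j1
  simp only [div_eq_mul_inv, mul_inv, inv_neg]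
  generalize (Complex.Gamma (y₁ - 1 - x₁))⁻¹ = A1
  generalize (Complex.Gamma (y₁ - 1 - x₂))⁻¹ = A2
  generalize (Complex.Gamma (y₁ - 1 - x₃))⁻¹ = A3
  generalize (Complex.Gamma (y₂ - x₁))⁻¹ = B1
  generalize (Complex.Gamma (y₂ - x₂))⁻¹ = B2
  generalize (Complex.Gamma (y₂ - x₃))⁻¹ = B3
  generalize (Complex.Gamma (y₃ - x₁))⁻¹ = C1
  generalize (Complex.Gamma (y₃ - x₂))⁻¹ = C2
  generalize (Complex.Gamma (y₃ - x₃))⁻¹ = C3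
  generalize (Complex.sin (Real.pi * x₂))⁻¹ = S2
  generalize (Complex.sin (Real.pi * x₃))⁻¹ = S3
  generalize (Complex.sin (Real.pi * (y₁ - x₁)))⁻¹ = T1
  generalize (Complex.sin (Real.pi * (y₂ - x₁)))⁻¹ = T2
  generalize (Complex.sin (Real.pi * (y₃ - x₁)))⁻¹ = T3
  linear_combination (Real.pi ^ 5 * (S2 * S3 * (T1 * T2 * T3)) * (A1 * A2 * A3) * (B1 * B2 * B3) *
    (C1 * C2 * C3)) * (hi - hj)

/-- Sum and closed form obey the same recurrence, whose coefficient at the unshifted point is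
nonzero by separation. -/
theorem tsum_eq_closedValue_of_shift_lower (h : Balanced x₁ x₂ x₃ y₁ y₂ y₃)
    (hs : Separated x₁ x₂ x₃ y₁ y₂ y₃)
    (hc : ∑' n, bterm x₁ x₂ x₃ (y₁ - 1) (y₂ + 1) y₃ n = closedValue x₁ x₂ x₃ (y₁ - 1) (y₂ + 1) y₃) :
    ∑' n, bterm x₁ x₂ x₃ y₁ y₂ y₃ n = closedValue x₁ x₂ x₃ y₁ y₂ y₃ := by
  have e := h.tsum_shift_lower
  rw [hc, hs.closedValue_shift_lower] at e
  have n1 : x₁ + 1 - y₁ ≠ 0 := fun h0 => hs.h₁₁ 1 (by push_cast; linear_combination -h0)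
  have n2 : x₂ + 1 - y₁ ≠ 0 := fun h0 => hs.h₁₂ 1 (by push_cast; linear_combination -h0)
  have n3 : x₃ + 1 - y₁ ≠ 0 := fun h0 => hs.h₁₃ 1 (by push_cast; linear_combination -h0)
  exact (mul_left_cancel₀ (mul_ne_zero (mul_ne_zero n1 n2) n3) e).symm

theorem gammaRatio_add_natCast (a b : ℂ) (n m : ℤ) :
    gammaRatio (a + m) (b + m) n = gammaRatio a b (m + n) := by
  rw [gammaRatio, gammaRatio]; push_cast; rw [add_assoc, add_assoc]

/-! ### The limit to Dougall's sum and the formula for separated parameters -/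

/-- The value of Dougall's sum attached to the second and third pair of parameters. -/
noncomputable def dougallValue (x₂ x₃ y₂ y₃ : ℂ) : ℂ :=
  Real.pi ^ 2 / (Complex.sin (Real.pi * x₂) * Complex.sin (Real.pi * x₃)) *
    (Complex.Gamma (y₂ + y₃ - x₂ - x₃ - 1) / (Complex.Gamma (y₂ - x₂) * Complex.Gamma (y₃ - x₃) *
      Complex.Gamma (y₃ - x₂) * Complex.Gamma (y₂ - x₃)))

/-- For fixed `n` the first ratio behaves like `N ^ (x₁ - y₁)`, so after normalization only the
other two ratios survive. -/
theorem Balanced.tendsto_tsum_shift (h : Balanced x₁ x₂ x₃ y₁ y₂ y₃)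
    (h₂ : 1 < (y₂ - x₂).re) (h₃ : 1 < (y₃ - x₃).re) :
    Tendsto (fun N : ℕ => (∑' n, bterm (x₁ + N) x₂ x₃ (y₁ + N) y₂ y₃ n) * (N : ℂ) ^ (y₁ - x₁)) atTop
      (𝓝 (dougallValue x₂ x₃ y₂ y₃)) := by
  have hD := hasSum_gammaRatio_mul_gammaRatio h.hx₂ h.hy₂ h.hx₃ h₂ h₃
  rw [dougallValue, ← hD.tsum_eq]
  simp_rw [← tsum_mul_right]
  obtain ⟨C₁, p₁, hC₁⟩ := exists_norm_gammaRatio_le h.hx₁ h.hy₁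
  obtain ⟨C₂, p₂, hC₂⟩ := exists_norm_gammaRatio_le h.hx₂ h.hy₂
  obtain ⟨C₃, p₃, hC₃⟩ := exists_norm_gammaRatio_le h.hx₃ h.hy₃
  have hre := congrArg Complex.re h.sum_eq
  simp at hre
  have h₂' := h₂
  have h₃' := h₃
  simp at h₂' h₃'
  -- By Saalschütz this equals `(y₂ - x₂).re + (y₃ - x₃).re - 2`. The sign permits raising `1 + |N +
  -- n| ≤ 2 (1 + |n|) N` to this power.
  have hδ : 0 ≤ x₁.re - y₁.re := by linarith
  refine tendsto_tsum_of_dominated_convergence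
    ((summable_one_add_abs_int_rpow (r := -2) (by norm_num)).mul_left
      (C₁ * 2 ^ (x₁.re - y₁.re) * C₂ * C₃)) (fun n => ?_) ?_
  · have := ((tendsto_gammaRatio_mul_cpow (x₁ + n) (y₁ + n)).mul_const
      (gammaRatio x₂ y₂ n * gammaRatio x₃ y₃ n))
    rw [one_mul] at this
    refine this.congr fun N => ?_
    rw [gammaRatio_add_natCast, bterm]
    have e := gammaRatio_add_natCast x₁ y₁ n N
    rw [Int.cast_natCast] at e
    rw [e, add_comm (N : ℤ), show y₁ + n - (x₁ + n) = y₁ - x₁ by ring]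
    ring
  · filter_upwards [eventually_gt_atTop 0] with N hN n
    have hN' : (1 : ℝ) ≤ N := by exact_mod_cast hN
    have hN0 : (0 : ℝ) < N := by linarith
    have e := gammaRatio_add_natCast x₁ y₁ n N
    rw [Int.cast_natCast] at e
    have hpos : 0 < 1 + |(n : ℝ)| := by positivity
    have h1 : ‖gammaRatio x₁ y₁ (N + n)‖ * (N : ℝ) ^ (y₁ - x₁).re ≤
        C₁ * 2 ^ (x₁.re - y₁.re) * (1 + |(n : ℝ)|) ^ (x₁.re - y₁.re) := by
      have hle : 1 + |((N + n : ℤ) : ℝ)| ≤ 2 * (1 + |(n : ℝ)|) * N := by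
        have := abs_add_le (N : ℝ) n
        rw [abs_of_pos hN0] at this
        push_cast
        nlinarith [abs_nonneg (n : ℝ)]
      have hpow := Real.rpow_le_rpow (by positivity) hle hδ
      rw [Real.mul_rpow (by positivity) hN0.le, Real.mul_rpow (by norm_num) hpos.le] at hpow
      have hcancel : (N : ℝ) ^ (x₁.re - y₁.re) * (N : ℝ) ^ (y₁ - x₁).re = 1 := by
        rw [← Real.rpow_add hN0]; simp
      calc ‖gammaRatio x₁ y₁ (N + n)‖ * (N : ℝ) ^ (y₁ - x₁).re
          ≤ (C₁ * (2 ^ (x₁.re - y₁.re) * (1 + |(n : ℝ)|) ^ (x₁.re - y₁.re) *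
            (N : ℝ) ^ (x₁.re - y₁.re))) * (N : ℝ) ^ (y₁ - x₁).re := by
            gcongr
            exact (hC₁ _).trans (by gcongr)
        _ = _ := by linear_combination (C₁ * (2 ^ (x₁.re - y₁.re) *
              (1 + |(n : ℝ)|) ^ (x₁.re - y₁.re))) * hcancel
    have e2 : (1 + |(n : ℝ)|) ^ (-2 : ℝ) = (1 + |(n : ℝ)|) ^ (x₁.re - y₁.re) *
        (1 + |(n : ℝ)|) ^ (x₂.re - y₂.re) * (1 + |(n : ℝ)|) ^ (x₃.re - y₃.re) := by
      rw [← Real.rpow_add hpos, ← Real.rpow_add hpos]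
      congr 1; linarith
    rw [bterm, e, norm_mul, norm_mul, norm_mul, Complex.norm_natCast_cpow_of_pos hN, e2]
    calc _ = (‖gammaRatio x₁ y₁ (N + n)‖ * (N : ℝ) ^ (y₁ - x₁).re) * ‖gammaRatio x₂ y₂ n‖ *
          ‖gammaRatio x₃ y₃ n‖ := by ring
      _ ≤ (C₁ * 2 ^ (x₁.re - y₁.re) * (1 + |(n : ℝ)|) ^ (x₁.re - y₁.re)) *
          (C₂ * (1 + |(n : ℝ)|) ^ (x₂.re - y₂.re)) * (C₃ * (1 + |(n : ℝ)|) ^ (x₃.re - y₃.re)) := by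
          gcongr
          · exact hC₂ n
          · exact hC₃ n
      _ = _ := by ring

theorem Balanced.shift_pair_natCast (h : Balanced x₁ x₂ x₃ y₁ y₂ y₃) (N : ℕ) :
    Balanced (x₁ + N) x₂ x₃ (y₁ + N) y₂ y₃ := by
  induction N with
  | zero => simpa using h
  | succ N ih =>
    have := ih.shift_pair
    rwa [add_assoc, add_assoc, ← Nat.cast_succ] at this

/-- Both sides of the formula are transported by the same recurrence under shifts of the first
pair of parameters. -/
theorem tsum_eq_of_one_lt_re (h : Balanced x₁ x₂ x₃ y₁ y₂ y₃) (hs : Separated x₁ x₂ x₃ y₁ y₂ y₃)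
    (h₂ : 1 < (y₂ - x₂).re) (h₃ : 1 < (y₃ - x₃).re) :
    ∑' n, bterm x₁ x₂ x₃ y₁ y₂ y₃ n = dougallValue x₂ x₃ y₂ y₃ *
      (gammaRatio (1 - (y₂ - x₁)) (y₁ - x₂) 0 * gammaRatio (1 - (y₃ - x₁)) (y₁ - x₃) 0) := by
  have n21 := one_sub_ne_int hs.h₂₁
  have n31 := one_sub_ne_int hs.h₃₁
  set S : ℕ → ℂ := fun N => ∑' n, bterm (x₁ + N) x₂ x₃ (y₁ + N) y₂ y₃ n with hS
  set R : ℕ → ℂ := fun N => dougallValue x₂ x₃ y₂ y₃ * (gammaRatio (1 - (y₂ - x₁)) (y₁ - x₂) N *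
    gammaRatio (1 - (y₃ - x₁)) (y₁ - x₃) N) with hR
  have hSlim := h.tendsto_tsum_shift h₂ h₃
  have hRlim : Tendsto (fun N : ℕ => R N * (N : ℂ) ^ (y₁ - x₁)) atTop
      (𝓝 (dougallValue x₂ x₃ y₂ y₃)) := by
    have := ((tendsto_gammaRatio_mul_cpow (1 - (y₂ - x₁)) (y₁ - x₂)).mul
      (tendsto_gammaRatio_mul_cpow (1 - (y₃ - x₁)) (y₁ - x₃))).const_mul (dougallValue x₂ x₃ y₂ y₃)
    rw [one_mul, mul_one] at this
    refine this.congr' ?_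
    filter_upwards [eventually_gt_atTop 0] with N hN
    have hN0 : (N : ℂ) ≠ 0 := by exact_mod_cast hN.ne'
    have e : (N : ℂ) ^ (y₁ - x₂ - (1 - (y₂ - x₁))) * (N : ℂ) ^ (y₁ - x₃ - (1 - (y₃ - x₁))) =
        (N : ℂ) ^ (y₁ - x₁) := by
      rw [← Complex.cpow_add _ _ hN0]
      congr 1
      linear_combination -h.sum_eq
    rw [hR, ← e]
    ring
  -- Proportionality is stated crosswise, so that no value of `S` or `R` has to be nonzero.
  have hprop (N : ℕ) : S 0 * R N = S N * R 0 := by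
    induction N with
    | zero => rfl
    | succ N ih =>
      have hrec := (h.shift_pair_natCast N).tsum_shift_pair
      have a2 := add_intCast_ne_zero hs.h₁₂ N
      have a3 := add_intCast_ne_zero hs.h₁₃ N
      have hSN : (y₁ - x₂ + (N : ℤ)) * (y₁ - x₃ + (N : ℤ)) * S (N + 1) =
          (1 - (y₂ - x₁) + (N : ℤ)) * (1 - (y₃ - x₁) + (N : ℤ)) * S N := by
        simp only [hS]
        push_cast at hrec ⊢
        rw [add_assoc, add_assoc] at hrec
        linear_combination hrec
      have hRN : (y₁ - x₂ + (N : ℤ)) * (y₁ - x₃ + (N : ℤ)) * R (N + 1) =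
          (1 - (y₂ - x₁) + (N : ℤ)) * (1 - (y₃ - x₁) + (N : ℤ)) * R N := by
        simp only [hR, Nat.cast_succ]
        rw [gammaRatio_add_one n21 hs.h₁₂, gammaRatio_add_one n31 hs.h₁₃]
        generalize gammaRatio (1 - (y₂ - x₁)) (y₁ - x₂) N = G
        generalize gammaRatio (1 - (y₃ - x₁)) (y₁ - x₃) N = H
        generalize (y₁ - x₂ + (N : ℤ)) = A at *
        generalize (y₁ - x₃ + (N : ℤ)) = B at *
        field_simp
      refine mul_left_cancel₀ (mul_ne_zero a2 a3) ?_
      linear_combination S 0 * hRN - R 0 * hSN +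
        (1 - (y₂ - x₁) + (N : ℤ)) * (1 - (y₃ - x₁) + (N : ℤ)) * ih
  have hD : dougallValue x₂ x₃ y₂ y₃ ≠ 0 := by
    have hre := congrArg Complex.re h.sum_eq
    simp at hre
    have h₂' := h₂
    have h₃' := h₃
    simp at h₂' h₃'
    have hpi : (Real.pi : ℂ) ≠ 0 := by exact_mod_cast Real.pi_ne_zero
    refine mul_ne_zero (div_ne_zero (pow_ne_zero 2 hpi) (mul_ne_zero (sin_pi_mul_ne_zero h.hx₂)
      (sin_pi_mul_ne_zero h.hx₃))) (div_ne_zero (Complex.Gamma_ne_zero_of_re_pos ?_)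
      (mul_ne_zero (mul_ne_zero (mul_ne_zero ?_ ?_) ?_) ?_))
    · simp; linarith
    · exact Gamma_ne_zero_of_ne_int hs.h₂₂
    · exact Gamma_ne_zero_of_ne_int hs.h₃₃
    · exact Gamma_ne_zero_of_ne_int hs.h₃₂
    · exact Gamma_ne_zero_of_ne_int hs.h₂₃
  have hfin := tendsto_nhds_unique (hRlim.const_mul (S 0)) ((hSlim.mul_const (R 0)).congr fun N => by
    linear_combination -((N : ℂ) ^ (y₁ - x₁)) * hprop N)
  have hSR : S 0 = R 0 := mul_right_cancel₀ hD (by rw [hfin, mul_comm])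
  simpa [hS, hR] using hSR

theorem Gamma_one_sub {z : ℂ} (hz : ∀ k : ℤ, z ≠ k) :
    Complex.Gamma (1 - z) = Real.pi / (Complex.sin (Real.pi * z) * Complex.Gamma z) := by
  have := sin_pi_mul_ne_zero hz
  have hG := Gamma_ne_zero_of_ne_int hz
  rw [eq_div_iff (mul_ne_zero this hG)]
  have h := Complex.Gamma_mul_Gamma_one_sub z
  rw [eq_div_iff this] at h
  linear_combination h

theorem tsum_eq_closedValue_of_one_lt_re (h : Balanced x₁ x₂ x₃ y₁ y₂ y₃)
    (hs : Separated x₁ x₂ x₃ y₁ y₂ y₃) (h₂ : 1 < (y₂ - x₂).re) (h₃ : 1 < (y₃ - x₃).re) :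
    ∑' n, bterm x₁ x₂ x₃ y₁ y₂ y₃ n = closedValue x₁ x₂ x₃ y₁ y₂ y₃ := by
  rw [tsum_eq_of_one_lt_re h hs h₂ h₃, dougallValue, gammaRatio, gammaRatio, Int.cast_zero,
    -- Dougall's numerator thus joins the other two as `Γ(1 - (yᵢ - x₁))`; reflection turns the
    -- three into the sines of the closed form.
    show y₂ + y₃ - x₂ - x₃ - 1 = 1 - (y₁ - x₁) by linear_combination -h.sum_eq]
  simp only [add_zero]
  rw [Gamma_one_sub hs.h₁₁, Gamma_one_sub hs.h₂₁, Gamma_one_sub hs.h₃₁, closedValue]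
  simp only [div_eq_mul_inv, mul_inv]
  ring

/-- Each lower shift raises `y₂` by one at the expense of `y₁`, whose real part is unrestricted; `M`
counts the shifts. -/
theorem tsum_eq_closedValue_of_one_lt_re_right (M : ℕ) (h : Balanced x₁ x₂ x₃ y₁ y₂ y₃)
    (hs : Separated x₁ x₂ x₃ y₁ y₂ y₃) (h₂ : 1 < (y₂ - x₂).re + M) (h₃ : 1 < (y₃ - x₃).re) :
    ∑' n, bterm x₁ x₂ x₃ y₁ y₂ y₃ n = closedValue x₁ x₂ x₃ y₁ y₂ y₃ := by
  induction M generalizing y₁ y₂ with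
  | zero => exact tsum_eq_closedValue_of_one_lt_re h hs (by simpa using h₂) h₃
  | succ M ih =>
    refine tsum_eq_closedValue_of_shift_lower h hs (ih h.shift_lower hs.shift_lower ?_)
    simp at h₂ ⊢
    linarith

theorem tsum_eq_closedValue_of_one_lt_re_add (M : ℕ) (h : Balanced x₁ x₂ x₃ y₁ y₂ y₃)
    (hs : Separated x₁ x₂ x₃ y₁ y₂ y₃) (h₃ : 1 < (y₃ - x₃).re + M) :
    ∑' n, bterm x₁ x₂ x₃ y₁ y₂ y₃ n = closedValue x₁ x₂ x₃ y₁ y₂ y₃ := by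
  induction M generalizing y₁ y₃ with
  | zero =>
    obtain ⟨K, hK⟩ := exists_nat_gt (1 - (y₂ - x₂).re)
    exact tsum_eq_closedValue_of_one_lt_re_right K h hs (by linarith) (by simpa using h₃)
  | succ M ih =>
    rw [← bterm_swap, ← closedValue_swap]
    refine tsum_eq_closedValue_of_shift_lower h.swap hs.swap ?_
    rw [← bterm_swap, ← closedValue_swap]
    refine ih h.swap.shift_lower.swap hs.swap.shift_lower.swap ?_
    simp at h₃ ⊢
    linarith

theorem tsum_eq_closedValue (h : Balanced x₁ x₂ x₃ y₁ y₂ y₃) (hs : Separated x₁ x₂ x₃ y₁ y₂ y₃) :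
    ∑' n, bterm x₁ x₂ x₃ y₁ y₂ y₃ n = closedValue x₁ x₂ x₃ y₁ y₂ y₃ := by
  obtain ⟨M, hM⟩ := exists_nat_gt (1 - (y₃ - x₃).re)
  exact tsum_eq_closedValue_of_one_lt_re_add M h hs (by linarith)

/-! ### Non-integral differences through the exponential cubics -/

theorem exp_two_pi_I_mul_eq_iff (a b : ℂ) :
    Complex.exp (2 * Real.pi * Complex.I * a) = Complex.exp (2 * Real.pi * Complex.I * b) ↔
      ∃ k : ℤ, a - b = k := by
  have h := Complex.two_pi_I_ne_zero
  rw [Complex.exp_eq_exp_iff_exists_int]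
  refine exists_congr fun k => ⟨fun e => mul_left_cancel₀ h (by linear_combination e), fun e => by
    linear_combination (2 * Real.pi * Complex.I) * e⟩

theorem exp_two_pi_I_mul_sub_one (a : ℂ) : Complex.exp (2 * Real.pi * Complex.I * a) - 1 =
    2 * Complex.I * Complex.exp (Real.pi * Complex.I * a) * Complex.sin (Real.pi * a) := by
  have e1 : Complex.exp (2 * Real.pi * Complex.I * a) =
      Complex.exp (Real.pi * Complex.I * a) * Complex.exp (Real.pi * Complex.I * a) := by
    rw [← Complex.exp_add]; congr 1; ring
  have e2 : Complex.exp (Real.pi * Complex.I * a) * Complex.exp (-(Real.pi * a) * Complex.I) = 1 := by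
    rw [← Complex.exp_add, ← Complex.exp_zero]; congr 1; ring
  have e3 : Complex.exp (Real.pi * a * Complex.I) = Complex.exp (Real.pi * Complex.I * a) := by
    congr 1; ring
  rw [Complex.sin, e1, e3]
  linear_combination -Complex.I ^ 2 * e2 +
    (Complex.exp (Real.pi * Complex.I * a) ^ 2 - 1) * Complex.I_sq

/-- The cubics with roots `exp (2πi y)` and `exp (2πi x)` differ by a multiple of `z * (z - 1)`. -/
theorem Balanced.exists_cubic_sub (h : Balanced x₁ x₂ x₃ y₁ y₂ y₃) :
    ∃ a : ℂ, ∀ z : ℂ,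
      (Complex.exp (2 * Real.pi * Complex.I * y₁) - z) *
          (Complex.exp (2 * Real.pi * Complex.I * y₂) - z) *
          (Complex.exp (2 * Real.pi * Complex.I * y₃) - z) -
        (Complex.exp (2 * Real.pi * Complex.I * x₁) - z) *
          (Complex.exp (2 * Real.pi * Complex.I * x₂) - z) *
          (Complex.exp (2 * Real.pi * Complex.I * x₃) - z) = a * (z * (z - 1)) := by
  have hprod : Complex.exp (2 * Real.pi * Complex.I * x₁) * Complex.exp (2 * Real.pi * Complex.I * x₂) *
      Complex.exp (2 * Real.pi * Complex.I * x₃) = Complex.exp (2 * Real.pi * Complex.I * y₁) *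
      Complex.exp (2 * Real.pi * Complex.I * y₂) * Complex.exp (2 * Real.pi * Complex.I * y₃) := by
    rw [← Complex.exp_add, ← Complex.exp_add, ← Complex.exp_add, ← Complex.exp_add, ← mul_add,
      ← mul_add, ← mul_add, ← mul_add, exp_two_pi_I_mul_eq_iff]
    exact ⟨-2, by push_cast; linear_combination h.sum_eq⟩
  have hhalf : Complex.exp (Real.pi * Complex.I * x₁) * Complex.exp (Real.pi * Complex.I * x₂) *
      Complex.exp (Real.pi * Complex.I * x₃) = Complex.exp (Real.pi * Complex.I * y₁) *
      Complex.exp (Real.pi * Complex.I * y₂) * Complex.exp (Real.pi * Complex.I * y₃) := by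
    rw [← Complex.exp_add, ← Complex.exp_add, ← Complex.exp_add, ← Complex.exp_add,
      Complex.exp_eq_exp_iff_exists_int]
    exact ⟨-1, by push_cast; linear_combination (Real.pi * Complex.I) * h.sum_eq⟩
  -- The leading terms cancel; `hprod` gives agreement of the cubics at `z = 0`, and
  -- half-exponentials times sines give it at `z = 1`.
  have hone := congrArg₂ (· * ·) hhalf h.sin_eq
  have ex₁ := exp_two_pi_I_mul_sub_one x₁
  have ex₂ := exp_two_pi_I_mul_sub_one x₂
  have ex₃ := exp_two_pi_I_mul_sub_one x₃
  have ey₁ := exp_two_pi_I_mul_sub_one y₁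
  have ey₂ := exp_two_pi_I_mul_sub_one y₂
  have ey₃ := exp_two_pi_I_mul_sub_one y₃
  have h1 : (Complex.exp (2 * Real.pi * Complex.I * x₁) - 1) *
      (Complex.exp (2 * Real.pi * Complex.I * x₂) - 1) *
      (Complex.exp (2 * Real.pi * Complex.I * x₃) - 1) =
      (Complex.exp (2 * Real.pi * Complex.I * y₁) - 1) *
      (Complex.exp (2 * Real.pi * Complex.I * y₂) - 1) *
      (Complex.exp (2 * Real.pi * Complex.I * y₃) - 1) := by
    rw [ex₁, ex₂, ex₃, ey₁, ey₂, ey₃]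
    linear_combination (2 * Complex.I) ^ 3 * hone
  refine ⟨Complex.exp (2 * Real.pi * Complex.I * y₁) + Complex.exp (2 * Real.pi * Complex.I * y₂) +
    Complex.exp (2 * Real.pi * Complex.I * y₃) - (Complex.exp (2 * Real.pi * Complex.I * x₁) +
    Complex.exp (2 * Real.pi * Complex.I * x₂) + Complex.exp (2 * Real.pi * Complex.I * x₃)),
    fun z => ?_⟩
  linear_combination (z - 1) * hprod - z * h1

theorem exp_two_pi_I_mul_ne_one {a : ℂ} (ha : ∀ k : ℤ, a ≠ k) :
    Complex.exp (2 * Real.pi * Complex.I * a) - 1 ≠ 0 := fun h => by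
  have h' : Complex.exp (2 * Real.pi * Complex.I * a) = Complex.exp (2 * Real.pi * Complex.I * 0) := by
    rw [mul_zero, Complex.exp_zero]; exact sub_eq_zero.1 h
  obtain ⟨k, hk⟩ := (exp_two_pi_I_mul_eq_iff _ _).1 h'
  exact ha k (by simpa using hk)

theorem exp_sub_exp_ne_zero {a b : ℂ} (h : ∀ k : ℤ, a - b ≠ k) :
    Complex.exp (2 * Real.pi * Complex.I * a) - Complex.exp (2 * Real.pi * Complex.I * b) ≠ 0 :=
  fun e => by
    obtain ⟨k, hk⟩ := (exp_two_pi_I_mul_eq_iff _ _).1 (sub_eq_zero.1 e)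
    exact h k hk

theorem sub_ne_int_of_exp_ne {a b : ℂ}
    (h : Complex.exp (2 * Real.pi * Complex.I * a) ≠ Complex.exp (2 * Real.pi * Complex.I * b)) :
    ∀ k : ℤ, a - b ≠ k := fun k hk => h ((exp_two_pi_I_mul_eq_iff _ _).2 ⟨k, hk⟩)

/-- At a common root `z` the left side vanishes, while `z` is neither `0` nor `1` because the `xⱼ`
are not integers. -/
theorem Balanced.separated_of_cubic_ne_zero (h : Balanced x₁ x₂ x₃ y₁ y₂ y₃) {a : ℂ} (ha : a ≠ 0)
    (hz : ∀ z : ℂ,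
      (Complex.exp (2 * Real.pi * Complex.I * y₁) - z) *
          (Complex.exp (2 * Real.pi * Complex.I * y₂) - z) *
          (Complex.exp (2 * Real.pi * Complex.I * y₃) - z) -
        (Complex.exp (2 * Real.pi * Complex.I * x₁) - z) *
          (Complex.exp (2 * Real.pi * Complex.I * x₂) - z) *
          (Complex.exp (2 * Real.pi * Complex.I * x₃) - z) = a * (z * (z - 1))) :
    Separated x₁ x₂ x₃ y₁ y₂ y₃ := by
  have key {x : ℂ} (hx : ∀ k : ℤ, x ≠ k) :
      a * (Complex.exp (2 * Real.pi * Complex.I * x) *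
        (Complex.exp (2 * Real.pi * Complex.I * x) - 1)) ≠ 0 :=
    mul_ne_zero ha (mul_ne_zero (Complex.exp_ne_zero _) (exp_two_pi_I_mul_ne_one hx))
  constructor <;> refine sub_ne_int_of_exp_ne fun e => ?_
  · exact key h.hx₁ (by rw [← hz, e]; ring)
  · exact key h.hx₂ (by rw [← hz, e]; ring)
  · exact key h.hx₃ (by rw [← hz, e]; ring)
  · exact key h.hx₁ (by rw [← hz, e]; ring)
  · exact key h.hx₂ (by rw [← hz, e]; ring)
  · exact key h.hx₃ (by rw [← hz, e]; ring)
  · exact key h.hx₁ (by rw [← hz, e]; ring)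
  · exact key h.hx₂ (by rw [← hz, e]; ring)
  · exact key h.hx₃ (by rw [← hz, e]; ring)

/-- If `a = 0` the cubics coincide, and the root attached to `x₁` would also be attached to some
`yᵢ`. -/
theorem Balanced.separated_of_upper (h : Balanced x₁ x₂ x₃ y₁ y₂ y₃)
    (h₁ : ∀ k : ℤ, y₁ - x₁ ≠ k) (h₂ : ∀ k : ℤ, y₂ - x₁ ≠ k) (h₃ : ∀ k : ℤ, y₃ - x₁ ≠ k) :
    Separated x₁ x₂ x₃ y₁ y₂ y₃ := by
  obtain ⟨a, hz⟩ := h.exists_cubic_sub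
  refine h.separated_of_cubic_ne_zero (fun ha => ?_) hz
  have := hz (Complex.exp (2 * Real.pi * Complex.I * x₁))
  rw [ha, sub_self, zero_mul, zero_mul, zero_mul, sub_zero] at this
  exact mul_ne_zero (mul_ne_zero (exp_sub_exp_ne_zero h₁) (exp_sub_exp_ne_zero h₂))
    (exp_sub_exp_ne_zero h₃) this

theorem Balanced.separated_of_lower (h : Balanced x₁ x₂ x₃ y₁ y₂ y₃)
    (h₁ : ∀ k : ℤ, x₁ - y₁ ≠ k) (h₂ : ∀ k : ℤ, x₂ - y₁ ≠ k) (h₃ : ∀ k : ℤ, x₃ - y₁ ≠ k) :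
    Separated x₁ x₂ x₃ y₁ y₂ y₃ := by
  obtain ⟨a, hz⟩ := h.exists_cubic_sub
  refine h.separated_of_cubic_ne_zero (fun ha => ?_) hz
  have := hz (Complex.exp (2 * Real.pi * Complex.I * y₁))
  rw [ha, sub_self, zero_mul, zero_mul, zero_mul, zero_sub, neg_eq_zero] at this
  exact mul_ne_zero (mul_ne_zero (exp_sub_exp_ne_zero h₁) (exp_sub_exp_ne_zero h₂))
    (exp_sub_exp_ne_zero h₃) this

theorem ne_int_of_sin_pi_mul_ne_zero {a : ℂ} (h : Complex.sin (Real.pi * a) ≠ 0) :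
    ∀ k : ℤ, a ≠ k := by
  rintro k rfl
  exact h (sin_pi_mul_intCast k)

end Bilateral

open Bilateral

theorem Admissible.balanced {x y : Fin 3 → ℂ} (h : Admissible x y) :
    Balanced (x 0) (x 1) (x 2) (y 0) (y 1) (y 2) := by
  obtain ⟨h1, h2, h3⟩ := h
  have hne : Complex.sin (Real.pi * y 0) * Complex.sin (Real.pi * y 1) *
      Complex.sin (Real.pi * y 2) ≠ 0 := by
    rw [← h2]
    exact mul_ne_zero (mul_ne_zero (sin_pi_mul_ne_zero (h3 0)) (sin_pi_mul_ne_zero (h3 1)))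
      (sin_pi_mul_ne_zero (h3 2))
  have hne' := mul_ne_zero_iff.1 hne
  have hne'' := mul_ne_zero_iff.1 hne'.1
  exact ⟨h3 0, h3 1, h3 2, ne_int_of_sin_pi_mul_ne_zero hne''.1,
    ne_int_of_sin_pi_mul_ne_zero hne''.2, ne_int_of_sin_pi_mul_ne_zero hne'.2, h1, h2⟩

theorem Bilateral.Balanced.admissible {x y : Fin 3 → ℂ}
    (h : Balanced (x 0) (x 1) (x 2) (y 0) (y 1) (y 2)) : Admissible x y := by
  refine ⟨h.sum_eq, h.sin_eq, fun j => ?_⟩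
  fin_cases j
  exacts [h.hx₁, h.hx₂, h.hx₃]

namespace Bilateral

theorem Separated.nonResonant {x y : Fin 3 → ℂ}
    (h : Separated (x 0) (x 1) (x 2) (y 0) (y 1) (y 2)) : NonResonant x y := by
  intro i
  fin_cases i
  exacts [h.h₁₁, h.h₂₁, h.h₃₁]

/-! ### Density of the regular parameters -/

theorem isOpenMap_cos_pi_mul : IsOpenMap fun w : ℂ => Complex.cos (Real.pi * w) := by
  have han : AnalyticOnNhd ℂ (fun w : ℂ => Complex.cos (Real.pi * w)) Set.univ := by
    refine DifferentiableOn.analyticOnNhd (Differentiable.differentiableOn ?_) isOpen_univ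
    fun_prop
  rcases han.is_constant_or_isOpen isPreconnected_univ with ⟨w, hw⟩ | h
  · exfalso
    have h0 := hw 0 trivial
    have h1 := hw 1 trivial
    simp at h0 h1
    rw [← h0] at h1
    norm_num at h1
  · exact fun s hs => h s (Set.subset_univ _) hs

/-- The zeros of the sine are simple, hence isolated. -/
theorem eventually_sub_ne_int (a b : ℂ) : ∀ᶠ e in 𝓝[≠] (0 : ℂ), ∀ k : ℤ, a - (b + e) ≠ k := by
  have hd : HasDerivAt (fun e : ℂ => Complex.sin (Real.pi * (a - (b + e))))
      (Complex.cos (Real.pi * (a - (b + 0))) * (Real.pi * -1)) 0 := by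
    have : HasDerivAt (fun e : ℂ => Real.pi * (a - (b + e))) (Real.pi * -1) 0 :=
      (((hasDerivAt_id (0 : ℂ)).const_add b).const_sub a).const_mul _
    exact this.csin
  have hev : ∀ᶠ e in 𝓝[≠] (0 : ℂ), Complex.sin (Real.pi * (a - (b + e))) ≠ 0 := by
    by_cases hc : Complex.cos (Real.pi * (a - (b + 0))) = 0
    · have hs : Complex.sin (Real.pi * (a - (b + 0))) ≠ 0 := fun hs => by
        have := Complex.sin_sq_add_cos_sq (Real.pi * (a - (b + 0)))
        rw [hs, hc] at this
        norm_num at this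
      exact (hd.continuousAt.eventually_ne hs).filter_mono nhdsWithin_le_nhds
    · refine hd.eventually_ne (mul_ne_zero hc ?_)
      simp [Real.pi_ne_zero]
  exact hev.mono fun e he => ne_int_of_sin_pi_mul_ne_zero he

theorem two_mul_sin_pi_mul_sin_pi (a b : ℂ) :
    2 * (Complex.sin (Real.pi * a) * Complex.sin (Real.pi * b)) =
      Complex.cos (Real.pi * (a - b)) - Complex.cos (Real.pi * (a + b)) := by
  rw [mul_sub, mul_add, Complex.cos_sub, Complex.cos_add]; ring

theorem mem_closure_regularParams {x y : Fin 3 → ℂ} (h : Admissible x y) :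
    (x, y) ∈ closure regularParams := by
  have hb := h.balanced
  have hsy := sin_pi_mul_ne_zero hb.hy₁
  rw [mem_closure_iff_nhds]
  intro U hU
  set w₀ := y 1 - y 2 with hw₀
  -- `x` stays fixed and `y 0` moves by `q.1`; the sum of the other two is dictated by Saalschütz,
  -- and `q.2` is their difference.
  let Φ : ℂ × ℂ → (Fin 3 → ℂ) × (Fin 3 → ℂ) := fun q =>
    (x, ![y 0 + q.1, (y 1 + y 2 - q.1 + q.2) / 2, (y 1 + y 2 - q.1 - q.2) / 2])
  have hΦ : Continuous Φ := by
    refine continuous_const.prodMk (continuous_pi fun i => ?_)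
    fin_cases i <;> simp <;> fun_prop
  have hΦ0 : Φ (0, w₀) = (x, y) := by
    simp only [Φ, hw₀]
    congr 1
    ext i
    fin_cases i <;> simp
  have hpre : ∀ᶠ q in 𝓝 ((0 : ℂ), w₀), Φ q ∈ U := hΦ.continuousAt (by rwa [hΦ0])
  rw [nhds_prod_eq] at hpre
  obtain ⟨V, hV, W, hW, hVW⟩ := Filter.eventually_prod_iff.1 hpre
  -- By the product-to-sum formula the periodicity condition becomes `cos (π w) = H e`. The open
  -- mapping theorem solves it near `w₀` even if the cosine has a critical point there.
  let H : ℂ → ℂ := fun e => 2 * (Complex.sin (Real.pi * x 0) * Complex.sin (Real.pi * x 1) *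
    Complex.sin (Real.pi * x 2)) / Complex.sin (Real.pi * (y 0 + e)) +
      Complex.cos (Real.pi * (y 1 + y 2 - e))
  have hHc : ContinuousAt H 0 := by
    refine ContinuousAt.add (ContinuousAt.div (by fun_prop) (by fun_prop) (by simpa using hsy))
      (by fun_prop)
  have hH0 : H 0 = Complex.cos (Real.pi * w₀) := by
    have := two_mul_sin_pi_mul_sin_pi (y 1) (y 2)
    simp only [H, add_zero, sub_zero]
    rw [h.2.1]
    field_simp
    linear_combination this
  have hHW : ∀ᶠ e in 𝓝 (0 : ℂ), H e ∈ (fun w : ℂ => Complex.cos (Real.pi * w)) '' {w | W w} := by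
    refine hHc ?_
    rw [hH0]
    exact isOpenMap_cos_pi_mul.image_mem_nhds hW
  have hsc : ∀ᶠ e in 𝓝 (0 : ℂ), Complex.sin (Real.pi * (y 0 + e)) ≠ 0 := by
    have : ContinuousAt (fun e : ℂ => Complex.sin (Real.pi * (y 0 + e))) 0 := by fun_prop
    exact this.eventually_ne (by simpa using hsy)
  obtain ⟨e, ⟨⟨⟨⟨⟨w, hWw, hwe⟩, hse⟩, hVe⟩, e0⟩, e1⟩, e2⟩ :=
    ((((((hHW.and hsc).and hV).filter_mono (nhdsWithin_le_nhds (s := {0}ᶜ))).and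
      (eventually_sub_ne_int (x 0) (y 0))).and (eventually_sub_ne_int (x 1) (y 0))).and
      (eventually_sub_ne_int (x 2) (y 0))).exists
  have hadm : Admissible x ![y 0 + e, (y 1 + y 2 - e + w) / 2, (y 1 + y 2 - e - w) / 2] := by
    refine ⟨?_, ?_, h.2.2⟩
    · simp
      linear_combination h.1
    · have := two_mul_sin_pi_mul_sin_pi ((y 1 + y 2 - e + w) / 2) ((y 1 + y 2 - e - w) / 2)
      rw [show (y 1 + y 2 - e + w) / 2 - (y 1 + y 2 - e - w) / 2 = w by ring,
        show (y 1 + y 2 - e + w) / 2 + (y 1 + y 2 - e - w) / 2 = y 1 + y 2 - e by ring] at this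
      simp only [H] at hwe
      rw [hwe, add_sub_cancel_right, eq_div_iff hse] at this
      simp
      linear_combination -this / 2
  have hsep := hadm.balanced.separated_of_lower (by simpa using e0) (by simpa using e1)
    (by simpa using e2)
  exact ⟨Φ (e, w), hVW hVe hWw, hadm, hsep.nonResonant⟩

/-! ### Continuity of the sum on the admissible set -/

theorem one_sub_le_rpow {m : ℝ} (hm : 0 < m) :
    1 - 3 / (2 * m) ≤ (m / (m + 1)) ^ (3 / 2 : ℝ) := by
  have h := one_add_mul_self_le_rpow_one_add (s := -(1 / (m + 1))) (p := 3 / 2)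
    (by rw [neg_le_neg_iff, div_le_one (by positivity)]; linarith) (by norm_num)
  have e : 1 + -(1 / (m + 1)) = m / (m + 1) := by field_simp; ring
  rw [e] at h
  refine le_trans ?_ h
  have : 1 / (m + 1) ≤ 1 / m := one_div_le_one_div_of_le hm (by linarith)
  have e2 : 3 / (2 * m) = 3 / 2 * (1 / m) := by field_simp
  rw [e2]
  linarith

/-- Raabe's estimate for the quotient of consecutive terms, uniform for bounded parameters. -/
theorem norm_prod_add_natCast_le {x₁ x₂ x₃ y₁ y₂ y₃ : ℂ} {R : ℝ} (hR : 1 ≤ R)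
    (hs : x₁ + x₂ + x₃ + 2 = y₁ + y₂ + y₃) (h₁ : ‖x₁‖ ≤ R) (h₂ : ‖x₂‖ ≤ R) (h₃ : ‖x₃‖ ≤ R)
    (k₁ : ‖y₁‖ ≤ R) (k₂ : ‖y₂‖ ≤ R) (k₃ : ‖y₃‖ ≤ R) {m : ℕ} (hm : 200 * R ^ 3 ≤ m) :
    ‖(x₁ + m) * (x₂ + m) * (x₃ + m)‖ ≤
      ‖(y₁ + m) * (y₂ + m) * (y₃ + m)‖ * (1 - 3 / (2 * (m : ℝ))) := by
  have hR0 : 0 < R := by linarith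
  have hR3 : 1 ≤ R ^ 3 := one_le_pow₀ hR
  have hR1 : R ≤ R ^ 3 := le_self_pow₀ hR (by norm_num)
  have hR2 : R ^ 2 ≤ R ^ 3 := pow_le_pow_right₀ hR (by norm_num)
  have hm1 : (1 : ℝ) ≤ m := by linarith
  have hm0 : (0 : ℝ) < m := by linarith
  have hmC : (m : ℂ) ≠ 0 := by exact_mod_cast hm0.ne'
  have hmn : ‖(m : ℂ)‖ = m := by simp
  have n2 {a b : ℂ} (ha : ‖a‖ ≤ R) (hb : ‖b‖ ≤ R) : ‖a * b‖ ≤ R ^ 2 := by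
    rw [norm_mul, pow_two]; gcongr
  have n3 {a b c : ℂ} (ha : ‖a‖ ≤ R) (hb : ‖b‖ ≤ R) (hc : ‖c‖ ≤ R) : ‖a * b * c‖ ≤ R ^ 3 := by
    rw [norm_mul, pow_succ]; gcongr; exact n2 ha hb
  set p₂ := y₁ + y₂ + y₃ with hp₂
  set p₁ := y₁ * y₂ + y₁ * y₃ + y₂ * y₃ with hp₁
  set p₀ := y₁ * y₂ * y₃ with hp₀
  set q₁ := x₁ * x₂ + x₁ * x₃ + x₂ * x₃ with hq₁
  set q₀ := x₁ * x₂ * x₃ with hq₀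
  have b2 : ‖p₂‖ ≤ 3 * R ^ 3 := by
    refine norm_add₃_le.trans ?_; linarith
  have b1 : ‖p₁‖ ≤ 3 * R ^ 3 := by
    refine norm_add₃_le.trans ?_; linarith [n2 k₁ k₂, n2 k₁ k₃, n2 k₂ k₃]
  have b0 : ‖p₀‖ ≤ R ^ 3 := n3 k₁ k₂ k₃
  have c1 : ‖q₁‖ ≤ 3 * R ^ 3 := by
    refine norm_add₃_le.trans ?_; linarith [n2 h₁ h₂, n2 h₁ h₃, n2 h₂ h₃]
  have c0 : ‖q₀‖ ≤ R ^ 3 := n3 h₁ h₂ h₃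
  set P := (y₁ + m) * (y₂ + m) * (y₃ + m) with hP
  have hPe : P = m ^ 3 + (p₂ * m ^ 2 + p₁ * m + p₀) := by rw [hP, hp₂, hp₁, hp₀]; ring
  have hPlow : (m : ℝ) ^ 3 / 2 ≤ ‖P‖ := by
    have h1 : ‖p₂ * (m : ℂ) ^ 2 + p₁ * m + p₀‖ ≤ 7 * R ^ 3 * (m : ℝ) ^ 2 := by
      refine norm_add₃_le.trans ?_
      rw [norm_mul, norm_mul, norm_pow, hmn]
      have hmm : (m : ℝ) ≤ (m : ℝ) ^ 2 := le_self_pow₀ hm1 (by norm_num)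
      have hm2 : (1 : ℝ) ≤ (m : ℝ) ^ 2 := one_le_pow₀ hm1
      have t2 : ‖p₂‖ * (m : ℝ) ^ 2 ≤ 3 * R ^ 3 * (m : ℝ) ^ 2 := by gcongr
      have t1 : ‖p₁‖ * (m : ℝ) ≤ 3 * R ^ 3 * (m : ℝ) ^ 2 := by gcongr
      have t0 : ‖p₀‖ ≤ R ^ 3 * (m : ℝ) ^ 2 := b0.trans (le_mul_of_one_le_right (by positivity) hm2)
      linarith
    have h2 : ‖(m : ℂ) ^ 3‖ = (m : ℝ) ^ 3 := by rw [norm_pow, hmn]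
    have h3 : (m : ℝ) ^ 3 ≤ ‖P‖ + ‖p₂ * (m : ℂ) ^ 2 + p₁ * m + p₀‖ := by
      rw [← h2]
      have : (m : ℂ) ^ 3 = P - (p₂ * m ^ 2 + p₁ * m + p₀) := by rw [hPe]; ring
      rw [this]
      exact norm_sub_le _ _
    have h4 : 7 * R ^ 3 * (m : ℝ) ^ 2 ≤ (m : ℝ) ^ 3 / 2 := by
      have : 14 * R ^ 3 ≤ m := by linarith
      have := mul_le_mul_of_nonneg_right this (sq_nonneg (m : ℝ))
      nlinarith
    linarith
  -- The `2` is Saalschütz's. Weakening `2/m` to `3/(2m)` leaves `‖P‖ / (2m) ≥ m² / 4`, which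
  -- absorbs the error `22 R³ m` once `m ≥ 88 R³`.
  have hQ : (x₁ + m) * (x₂ + m) * (x₃ + m) = P * ((1 - 2 / m : ℝ) : ℂ) +
      (2 * p₂ * m + 2 * p₁ + 2 * p₀ / m + (q₁ - p₁) * m + (q₀ - p₀)) := by
    rw [hPe]
    have : x₁ + x₂ + x₃ = p₂ - 2 := by linear_combination hs
    push_cast
    field_simp
    rw [hq₁, hq₀]
    linear_combination (m : ℂ) ^ 3 * this
  have hE : ‖2 * p₂ * m + 2 * p₁ + 2 * p₀ / m + (q₁ - p₁) * m + (q₀ - p₀)‖ ≤ 22 * R ^ 3 * m := by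
    have hle : R ^ 3 ≤ R ^ 3 * m := le_mul_of_one_le_right (by positivity) hm1
    have t1 : ‖2 * p₂ * m‖ ≤ 6 * R ^ 3 * m := by
      rw [norm_mul, norm_mul, hmn, Complex.norm_two]
      linarith [mul_le_mul_of_nonneg_right b2 hm0.le]
    have t2 : ‖2 * p₁‖ ≤ 6 * R ^ 3 * m := by
      rw [norm_mul, Complex.norm_two]; linarith
    have t3 : ‖2 * p₀ / m‖ ≤ 2 * R ^ 3 * m := by
      rw [norm_div, norm_mul, Complex.norm_two, hmn]
      refine (div_le_self (by positivity) hm1).trans ?_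
      linarith
    have t4 : ‖(q₁ - p₁) * m‖ ≤ 6 * R ^ 3 * m := by
      rw [norm_mul, hmn]; gcongr
      exact (norm_sub_le _ _).trans (by linarith)
    have t5 : ‖q₀ - p₀‖ ≤ 2 * R ^ 3 * m := (norm_sub_le _ _).trans (by linarith)
    refine (norm_add_le _ _).trans ?_
    have := norm_add_le (2 * p₂ * m + 2 * p₁ + 2 * p₀ / m) ((q₁ - p₁) * (m : ℂ))
    have := norm_add₃_le (a := 2 * p₂ * m) (b := 2 * p₁) (c := 2 * p₀ / (m : ℂ))
    linarith
  have hpos : 0 ≤ 1 - 2 / (m : ℝ) := by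
    rw [sub_nonneg, div_le_one hm0]; linarith
  rw [hQ]
  refine (norm_add_le _ _).trans ?_
  rw [norm_mul, Complex.norm_real, Real.norm_of_nonneg hpos]
  have hfin : 22 * R ^ 3 * m ≤ ‖P‖ * (1 / (2 * m)) := by
    calc 22 * R ^ 3 * m ≤ (m : ℝ) ^ 3 / 2 * (1 / (2 * m)) := by
          field_simp
          have : 88 * R ^ 3 ≤ m := by linarith
          nlinarith
      _ ≤ _ := by gcongr
  have e : ‖P‖ * (1 - 3 / (2 * (m : ℝ))) = ‖P‖ * (1 - 2 / m) + ‖P‖ * (1 / (2 * m)) := by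
    field_simp; ring
  linarith

/-- The general term as a function of the pair of parameter triples. -/
noncomputable def pterm (p : (Fin 3 → ℂ) × (Fin 3 → ℂ)) (n : ℤ) : ℂ :=
  bterm (p.1 0) (p.1 1) (p.1 2) (p.2 0) (p.2 1) (p.2 2) n

/-- The set of admissible pairs of parameter triples. -/
def admissibleParams : Set ((Fin 3 → ℂ) × (Fin 3 → ℂ)) := {p | Admissible p.1 p.2}

/-- Monotonicity of `‖term‖ * m ^ (3/2)` lets a single term, continuous in the parameters, dominate
the whole tail locally uniformly. -/
theorem norm_pterm_add_one_le {p : (Fin 3 → ℂ) × (Fin 3 → ℂ)} (hp : p ∈ admissibleParams) {R : ℝ}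
    (hR : 1 ≤ R) (hpR : ‖p‖ ≤ R) {m : ℕ} (hm : 200 * R ^ 3 ≤ m) :
    ‖pterm p ((m : ℤ) + 1)‖ * ((m : ℝ) + 1) ^ (3 / 2 : ℝ) ≤ ‖pterm p m‖ * (m : ℝ) ^ (3 / 2 : ℝ) := by
  have h := Admissible.balanced hp
  have hm0 : (0 : ℝ) < m := by
    have := one_le_pow₀ hR (n := 3)
    linarith
  have bx (i : Fin 3) : ‖p.1 i‖ ≤ R := (norm_le_pi_norm p.1 i).trans ((norm_fst_le p).trans hpR)
  have bby (i : Fin 3) : ‖p.2 i‖ ≤ R := (norm_le_pi_norm p.2 i).trans ((norm_snd_le p).trans hpR)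
  have key := norm_prod_add_natCast_le hR h.sum_eq (bx 0) (bx 1) (bx 2) (bby 0) (bby 1) (bby 2) hm
  have d := mul_ne_zero (mul_ne_zero (add_intCast_ne_zero h.hy₁ m) (add_intCast_ne_zero h.hy₂ m))
    (add_intCast_ne_zero h.hy₃ m)
  rw [Int.cast_natCast] at d
  have hd : 0 < ‖(p.2 0 + m) * (p.2 1 + m) * (p.2 2 + m)‖ := norm_pos_iff.2 d
  have e : pterm p ((m : ℤ) + 1) = pterm p m * (((p.1 0 + m) * (p.1 1 + m) * (p.1 2 + m)) /
      ((p.2 0 + m) * (p.2 1 + m) * (p.2 2 + m))) := by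
    rw [pterm, pterm, bterm, bterm, gammaRatio_add_one h.hx₁ h.hy₁, gammaRatio_add_one h.hx₂ h.hy₂,
      gammaRatio_add_one h.hx₃ h.hy₃, Int.cast_natCast, ← div_mul_div_comm, ← div_mul_div_comm]
    ring
  have hq : ‖((p.1 0 + m) * (p.1 1 + m) * (p.1 2 + m)) /
      ((p.2 0 + m) * (p.2 1 + m) * (p.2 2 + m))‖ ≤ (m / (m + 1) : ℝ) ^ (3 / 2 : ℝ) := by
    rw [norm_div, div_le_iff₀' hd]
    exact key.trans (mul_le_mul_of_nonneg_left (one_sub_le_rpow hm0) hd.le)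
  rw [Real.div_rpow hm0.le (by positivity), le_div_iff₀ (by positivity)] at hq
  rw [e, norm_mul, mul_assoc]
  exact mul_le_mul_of_nonneg_left hq (norm_nonneg _)

theorem norm_pterm_add_le {p : (Fin 3 → ℂ) × (Fin 3 → ℂ)} (hp : p ∈ admissibleParams) {R : ℝ}
    (hR : 1 ≤ R) (hpR : ‖p‖ ≤ R) {m : ℕ} (hm : 200 * R ^ 3 ≤ m) (n : ℕ) :
    ‖pterm p ((n + m : ℕ) : ℤ)‖ * ((n + m : ℕ) : ℝ) ^ (3 / 2 : ℝ) ≤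
      ‖pterm p m‖ * (m : ℝ) ^ (3 / 2 : ℝ) := by
  induction n with
  | zero => simp
  | succ n ih =>
    refine le_trans ?_ ih
    have hm' : 200 * R ^ 3 ≤ ((n + m : ℕ) : ℝ) := by
      push_cast
      have : (0 : ℝ) ≤ n := n.cast_nonneg
      linarith
    have := norm_pterm_add_one_le hp hR hpR hm'
    have e : n + 1 + m = (n + m) + 1 := by ring
    rw [e]
    exact_mod_cast this

theorem continuousAt_Gamma_of_ne_int {a : ℂ} (ha : ∀ k : ℤ, a ≠ k) :
    ContinuousAt Complex.Gamma a :=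
  (Complex.differentiableAt_Gamma a fun m h => ha (-m) (by simpa using h)).continuousAt

theorem continuousAt_pterm {p : (Fin 3 → ℂ) × (Fin 3 → ℂ)} (hp : p ∈ admissibleParams) (n : ℤ) :
    ContinuousAt (fun q => pterm q n) p := by
  have h := Admissible.balanced hp
  have key {a b : (Fin 3 → ℂ) × (Fin 3 → ℂ) → ℂ} (ha : Continuous a) (hb : Continuous b)
      (hap : ∀ k : ℤ, a p ≠ k) (hbp : ∀ k : ℤ, b p ≠ k) :
      ContinuousAt (fun q => gammaRatio (a q) (b q) n) p := by
    simp only [gammaRatio]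
    refine ContinuousAt.div ?_ ?_ (Gamma_ne_zero_of_ne_int (add_intCast_ne_int hbp n))
    · exact ContinuousAt.comp (f := fun q => a q + n)
        (continuousAt_Gamma_of_ne_int (add_intCast_ne_int hap n)) (by fun_prop)
    · exact ContinuousAt.comp (f := fun q => b q + n)
        (continuousAt_Gamma_of_ne_int (add_intCast_ne_int hbp n)) (by fun_prop)
  exact ((key (by fun_prop) (by fun_prop) h.hx₁ h.hy₁).mul
    (key (by fun_prop) (by fun_prop) h.hx₂ h.hy₂)).mul
    (key (by fun_prop) (by fun_prop) h.hx₃ h.hy₃)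

theorem summable_pterm {p : (Fin 3 → ℂ) × (Fin 3 → ℂ)} (hp : p ∈ admissibleParams) :
    Summable (pterm p) := (Admissible.balanced hp).summable

theorem summable_pterm_natCast {p : (Fin 3 → ℂ) × (Fin 3 → ℂ)} (hp : p ∈ admissibleParams) :
    Summable fun n : ℕ => pterm p n := (summable_pterm hp).comp_injective Nat.cast_injective

theorem continuousWithinAt_tsum_pterm_natCast {p : (Fin 3 → ℂ) × (Fin 3 → ℂ)}
    (hp : p ∈ admissibleParams) :
    ContinuousWithinAt (fun q => ∑' n : ℕ, pterm q n) admissibleParams p := by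
  set R := ‖p‖ + 1 with hRdef
  have hR : 1 ≤ R := by linarith [norm_nonneg p]
  obtain ⟨m, hm⟩ := exists_nat_ge (200 * R ^ 3)
  have hmpos : (0 : ℝ) < m := by
    have := one_le_pow₀ hR (n := 3)
    linarith
  have hsplit : ∀ᶠ q in 𝓝[admissibleParams] p, ∑ n ∈ Finset.range m, pterm q n +
      ∑' n : ℕ, pterm q ((n + m : ℕ) : ℤ) = ∑' n : ℕ, pterm q n := by
    filter_upwards [self_mem_nhdsWithin] with q hq
    exact (summable_pterm_natCast hq).sum_add_tsum_nat_add m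
  have hnear : ∀ᶠ q in 𝓝[admissibleParams] p, ‖q‖ ≤ R := by
    have : ∀ᶠ q in 𝓝 p, ‖q‖ < R := continuous_norm.continuousAt.eventually_lt_const (by linarith)
    exact (this.mono fun _ h => h.le).filter_mono nhdsWithin_le_nhds
  have hterm : ∀ᶠ q in 𝓝[admissibleParams] p, ‖pterm q m‖ ≤ ‖pterm p m‖ + 1 := by
    have : ∀ᶠ q in 𝓝 p, ‖pterm q m‖ < ‖pterm p m‖ + 1 :=
      (continuousAt_pterm hp m).norm.eventually_lt_const (by linarith)
    exact (this.mono fun _ h => h.le).filter_mono nhdsWithin_le_nhds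
  have hbound : Summable fun n : ℕ => (‖pterm p m‖ + 1) * (m : ℝ) ^ (3 / 2 : ℝ) *
      (1 / ((n + m : ℕ) : ℝ) ^ (3 / 2 : ℝ)) :=
    ((summable_nat_add_iff m).2 (Real.summable_one_div_nat_rpow.2 (by norm_num))).mul_left _
  have htail : Tendsto (fun q => ∑' n : ℕ, pterm q ((n + m : ℕ) : ℤ)) (𝓝[admissibleParams] p)
      (𝓝 (∑' n : ℕ, pterm p ((n + m : ℕ) : ℤ))) := by
    refine tendsto_tsum_of_dominated_convergence hbound
      (fun n => (continuousAt_pterm hp _).tendsto.mono_left nhdsWithin_le_nhds) ?_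
    filter_upwards [self_mem_nhdsWithin, hnear, hterm] with q hq hqR hqm n
    have hpos : (0 : ℝ) < ((n + m : ℕ) : ℝ) := by
      push_cast
      have : (0 : ℝ) ≤ n := n.cast_nonneg
      linarith
    rw [mul_one_div, le_div_iff₀ (by positivity)]
    exact (norm_pterm_add_le hq hR hqR hm n).trans (by gcongr)
  have hhead : Tendsto (fun q => ∑ n ∈ Finset.range m, pterm q n) (𝓝[admissibleParams] p)
      (𝓝 (∑ n ∈ Finset.range m, pterm p n)) :=
    tendsto_finsetSum _ fun n _ =>
      (continuousAt_pterm hp _).tendsto.mono_left nhdsWithin_le_nhds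
  have := (hhead.add htail).congr' hsplit
  rwa [(summable_pterm_natCast hp).sum_add_tsum_nat_add m] at this

/-- The reflection `(x, y) ↦ (1 - y, 1 - x)` of the parameters. -/
def reflectParams (p : (Fin 3 → ℂ) × (Fin 3 → ℂ)) : (Fin 3 → ℂ) × (Fin 3 → ℂ) := (1 - p.2, 1 - p.1)

theorem reflectParams_mem {p : (Fin 3 → ℂ) × (Fin 3 → ℂ)} (hp : p ∈ admissibleParams) :
    reflectParams p ∈ admissibleParams :=
  Balanced.admissible (Admissible.balanced hp).reflect

theorem continuous_reflectParams : Continuous reflectParams := by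
  unfold reflectParams; fun_prop

theorem tsum_pterm {p : (Fin 3 → ℂ) × (Fin 3 → ℂ)} (hp : p ∈ admissibleParams) :
    -- The negative half is the positive half at the reflected parameters, without its term at `0`.
    ∑' n, pterm p n = ∑' n : ℕ, pterm p n +
      (∑' n : ℕ, pterm (reflectParams p) n - pterm (reflectParams p) 0) := by
  have hr := reflectParams_mem hp
  have e (n : ℕ) : pterm p (-(n + 1 : ℤ)) = pterm (reflectParams p) ((n + 1 : ℕ) : ℤ) := by
    have := (Admissible.balanced hp).bterm_neg ((n + 1 : ℕ) : ℤ)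
    exact_mod_cast this
  have s2 : Summable fun n : ℕ => pterm p (-(n + 1 : ℤ)) := by
    simp only [e]
    exact (summable_nat_add_iff 1).2 (summable_pterm_natCast hr)
  rw [tsum_of_nat_of_neg_add_one (summable_pterm_natCast hp) s2,
    (summable_pterm_natCast hr).tsum_eq_zero_add]
  simp only [e]
  simp

theorem continuousWithinAt_tsum_pterm {p : (Fin 3 → ℂ) × (Fin 3 → ℂ)} (hp : p ∈ admissibleParams) :
    ContinuousWithinAt (fun q => ∑' n : ℤ, pterm q n) admissibleParams p := by
  have hr := reflectParams_mem hp
  have hmaps : Set.MapsTo reflectParams admissibleParams admissibleParams :=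
    fun q hq => reflectParams_mem hq
  have hrc := continuous_reflectParams.continuousWithinAt (s := admissibleParams) (x := p)
  have h1 := continuousWithinAt_tsum_pterm_natCast hp
  have h2 := (continuousWithinAt_tsum_pterm_natCast hr).comp hrc hmaps
  have h3 := (continuousAt_pterm hr 0).comp_continuousWithinAt hrc
  exact (h1.add (h2.sub h3)).congr (fun q hq => tsum_pterm hq) (tsum_pterm hp)

end Bilateral

/-! ### Assembly of the theorem -/

open Bilateral

theorem bilateralTerm_eq_pterm (x y : Fin 3 → ℂ) : bilateralTerm x y = pterm (x, y) := by
  funext n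
  rw [bilateralTerm, Fin.prod_univ_three]
  rfl

theorem closedForm_eq_closedValue (x y : Fin 3 → ℂ) :
    closedForm x y = closedValue (x 0) (x 1) (x 2) (y 0) (y 1) (y 2) := by
  simp only [closedForm, trigG, Fin.prod_univ_three, closedValue]

theorem trigG_eq_gammaG (x y : Fin 3 → ℂ) : trigG x y = gammaG x y := by
  have e (i : Fin 3) : 1 - y i + x 0 = 1 - (y i - x 0) := by ring
  simp only [trigG, gammaG, Fin.prod_univ_three, e, Complex.Gamma_mul_Gamma_one_sub]
  simp only [div_eq_mul_inv, mul_inv]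
  ring

theorem tsum_pterm_eq_closedForm {x y : Fin 3 → ℂ} (h : Admissible x y) (hr : NonResonant x y) :
    ∑' n, pterm (x, y) n = closedForm x y := by
  rw [closedForm_eq_closedValue]
  exact tsum_eq_closedValue h.balanced (h.balanced.separated_of_upper (hr 0) (hr 1) (hr 2))

theorem mainTheorem1 (x y : Fin 3 → ℂ) (hxy : Admissible x y) :
    Summable (bilateralTerm x y) ∧
    (NonResonant x y →
      trigG x y = gammaG x y ∧ ∑' n : ℤ, bilateralTerm x y n = closedForm x y) ∧
    (x, y) ∈ closure regularParams ∧
    Tendsto (fun p : (Fin 3 → ℂ) × (Fin 3 → ℂ) => closedForm p.1 p.2)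
      (𝓝[regularParams] (x, y)) (𝓝 (∑' n : ℤ, bilateralTerm x y n)) := by
  rw [bilateralTerm_eq_pterm]
  refine ⟨summable_pterm hxy, fun hr => ⟨trigG_eq_gammaG x y, tsum_pterm_eq_closedForm hxy hr⟩,
    mem_closure_regularParams hxy, ?_⟩
  have hsub : regularParams ⊆ admissibleParams := fun p hp => hp.1
  -- On regular parameters the closed form is the sum itself, so its limit is an instance of the
  -- continuity of the sum.
  refine ((continuousWithinAt_tsum_pterm (p := (x, y)) hxy).mono hsub).tendsto.congr' ?_
  filter_upwards [self_mem_nhdsWithin] with p hp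
  exact tsum_pterm_eq_closedForm hp.1 hp.2
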